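/- **Graded multiplicities for $D_n$.** Let $n\ge 3$ and let $k$ be a field of characteristic $0$. Let $\Gamma_{D_n}$ be the Hasse graph of the $n$-gon: with indices in $\mathbb Z/n$, its vertices are $u$ (level 3), $v_{i,i+1}$ (level 2), $w_i$ (level 1) and $*$ (level 0), and its edges are $u\to v_{i,i+1}$, $v_{i,i+1}\to w_i$, $v_{i,i+1}\to w_{i+1}$, $w_i\to *$. Let $A=A(\Gamma_{D_n})=T(E)/R$, where $T(E)$ is the free associative $k$-algebra on the set $E$ of edges and $R$ is the two-sided ideal generated by all $e(\pi_1,d)-e(\pi_2,d)$, with $\pi_1,\pi_2$ paths having the same tail and the same head, $1\le d\le \mathrm{length}(\pi_1)$, and $e(\pi,d)=\sum_{1\le i_1<\dots<i_d\le m}e_{i_1}\cdots e_{i_d}$ for a path $\pi=(e_1,\dots,e_m)$. Let $A_{[d]}$ be the span of the products of $d$ edges. The dihedral group $D_n$ of order $2n$, generated by the rotation $r: w_i\mapsto w_{i+1}$ and the reflection $s: w_i\mapsto w_{3-i}$, acts on $\Gamma_{D_n}$, hence on $A$ and on each $A_{[d]}$. Put $$a=\frac1{1-((2n+1)t-(2n-1)t^2+t^3)},\qquad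 b=\frac1{1-(t+t^2+t^3)},\qquad c=\frac1{1-(3t+t^2-t^3)} .$$ Then the graded trace $\sum_d \mathrm{Tr}(g|_{A_{[d]}})\,t^d$ equals $a$ for $g=1$, $b$ for every rotation $g\neq1$, and $c$ for every reflection $g$. Moreover, for an irreducible representation $\phi$ of $D_n$ over $k$ let $m_\phi(t)=\sum_d m_{\phi,d}\,t^d$, where $m_{\phi,d}$ is the multiplicity of $\phi$ in $A_{[d]}$. Let $\zeta$ be a primitive $n$-th root of unity in some extension field of $k$. * If $\phi$ has the trivial character, then $m_\phi=\frac1{2n}a+\frac{n-1}{2n}b+\frac12c$. * If $\phi$ has the character with value $1$ at all rotations and $-1$ at all reflections, then $m_\phi=\frac1{2n}a+\frac{n-1}{2n}b-\frac12c$. * If $n$ is even and $\phi$ has one of the two characters with $r^i\mapsto(-1)^i$, $sr^i\mapsto \pm(-1)^i$, then $m_\phi=\frac1{2n}(a-b)$. * If $1\le j<n/2$ and $\phi$ has the character $\chi_j$ with $\chi_j(r^i)=\zeta^{ij}+\zeta^{-ij}$ (that is, $2\cos(2\pi ij/n)$ for $\zeta=e^{2\pi \mathrm i/n}$) and $\chi_j(sr^i)=0$,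 then $m_\phi=\frac1n(a-b)$. -/

import Mathlib

open scoped PowerSeries MonoidAlgebra

/-- A layered graph: a directed graph (with edges `E`, tails and heads) whose vertices are
distributed over finitely many levels, every edge going down exactly one level, with a single
vertex `root` of level `0`, and such that every other vertex is the tail of an edge. -/
structure LayeredGraph (V E : Type*) where
  tail : E → V
  head : E → V
  level : V → ℕ
  root : V
  level_tail : ∀ e, level (tail e) = level (head e) + 1
  level_eq_zero_iff : ∀ v, level v = 0 ↔ v = root
  exists_tail : ∀ v, v ≠ root → ∃ e, tail e = v
  level_bounded : ∃ N, ∀ v, level v ≤ N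

namespace LayeredGraph

variable {V E : Type*} (Γ : LayeredGraph V E)

/-- `Γ.IsPath v π w` says that the list of edges `π = [e₁, …, e_m]` is a path from `v` to `w`. -/
def IsPath : V → List E → V → Prop
  | v, [], w => v = w
  | v, e :: π, w => Γ.tail e = v ∧ IsPath (Γ.head e) π w

/-- For `π = [e₁, …, e_m]` the element `e(π, d) = ∑_{i₁ < ⋯ < i_d} e_{i₁} ⋯ e_{i_d}` of the free
associative algebra on the edges. -/
noncomputable def pathElem (k : Type*) [Field k] (π : List E) (d : ℕ) : FreeAlgebra k E :=
  ((π.sublistsLen d).map fun l => (l.map (FreeAlgebra.ι k)).prod).sum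

/-- The defining relations of `A(Γ)`: `e(π₁, d) = e(π₂, d)` whenever `π₁` and `π₂` are paths with
the same tail and the same head and `1 ≤ d ≤ length π₁`. -/
def Rel (k : Type*) [Field k] (x y : FreeAlgebra k E) : Prop :=
  ∃ (v w : V) (π₁ π₂ : List E) (d : ℕ), Γ.IsPath v π₁ w ∧ Γ.IsPath v π₂ w ∧
    1 ≤ d ∧ d ≤ π₁.length ∧ x = pathElem k π₁ d ∧ y = pathElem k π₂ d

/-- The algebra `A(Γ) = T(E) / R`. -/
abbrev Alg (k : Type*) [Field k] : Type _ := RingQuot (Γ.Rel k)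

/-- The image in `A(Γ)` of an edge. -/
noncomputable def gen (k : Type*) [Field k] (e : E) : Γ.Alg k :=
  RingQuot.mkAlgHom k (Γ.Rel k) (FreeAlgebra.ι k e)

/-- The homogeneous component `A(Γ)_[d]`, spanned by the products of `d` edges. -/
noncomputable def component (k : Type*) [Field k] (d : ℕ) : Submodule k (Γ.Alg k) :=
  Submodule.span k {x | ∃ l : List E, l.length = d ∧ x = (l.map (Γ.gen k)).prod}

/-- The group `G` acts on the layered graph `Γ` by automorphisms (preserving the levels). -/
class ActsOn (G : Type*) [Group G] [MulAction G V] [MulAction G E] : Prop where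
  tail_smul : ∀ (g : G) (e : E), Γ.tail (g • e) = g • Γ.tail e
  head_smul : ∀ (g : G) (e : E), Γ.head (g • e) = g • Γ.head e
  level_smul : ∀ (g : G) (v : V), Γ.level (g • v) = Γ.level v

section Action

variable (k : Type*) [Field k] {G : Type*} [Group G] [MulAction G V] [MulAction G E]

theorem IsPath.smul [Γ.ActsOn G] (g : G) {π : List E} {v w : V} (h : Γ.IsPath v π w) :
    Γ.IsPath (g • v) (π.map (g • ·)) (g • w) := by
  induction π generalizing v with
  | nil => exact congrArg (g • ·) h
  | cons e π ih =>
    refine ⟨?_, ?_⟩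
    · rw [ActsOn.tail_smul, h.1]
    · rw [ActsOn.head_smul]; exact ih h.2

theorem sublistsLen_map_aux {α β : Type*} (f : α → β) (l : List α) (d : ℕ) :
    (l.map f).sublistsLen d = (l.sublistsLen d).map (List.map f) := by
  induction l generalizing d with
  | nil => cases d <;> simp
  | cons a l ih => cases d <;> simp [ih, Function.comp_def]

theorem lift_pathElem (g : G) (π : List E) (d : ℕ) :
    FreeAlgebra.lift k (fun e => FreeAlgebra.ι k (g • e)) (pathElem k π d) =
      pathElem k (π.map (g • ·)) d := by
  unfold pathElem
  rw [map_list_sum, List.map_map, sublistsLen_map_aux, List.map_map]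
  congr 1
  refine List.map_congr_left fun l _ => ?_
  simp [map_list_prod, Function.comp_def]

/-- The endomorphism of the algebra `A(Γ)` induced by an element of a group acting on `Γ`; it sends
the edge `e` to the edge `g • e`. -/
noncomputable def autHom [Γ.ActsOn G] (g : G) : Γ.Alg k →ₐ[k] Γ.Alg k :=
  RingQuot.liftAlgHom k ⟨FreeAlgebra.lift k fun e => Γ.gen k (g • e), by
    rintro x y ⟨v, w, π₁, π₂, d, h₁, h₂, hd, hd', rfl, rfl⟩
    have key : (FreeAlgebra.lift k fun e => Γ.gen k (g • e)) =
        (RingQuot.mkAlgHom k (Γ.Rel k)).comp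
          (FreeAlgebra.lift k fun e => FreeAlgebra.ι k (g • e)) := by
      ext e; simp [gen]
    rw [key, AlgHom.comp_apply, AlgHom.comp_apply, lift_pathElem, lift_pathElem]
    exact RingQuot.mkAlgHom_rel k ⟨_, _, _, _, d, IsPath.smul Γ g h₁, IsPath.smul Γ g h₂, hd,
      by simpa using hd', rfl, rfl⟩⟩

@[simp]
theorem autHom_gen [Γ.ActsOn G] (g : G) (e : E) :
    Γ.autHom k g (Γ.gen k e) = Γ.gen k (g • e) := by
  simp [autHom, gen]

/-- The representation on `A(Γ)` of a group acting on `Γ`. -/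
noncomputable def algRep (G : Type*) [Group G] [MulAction G V] [MulAction G E] [Γ.ActsOn G] :
    Representation k G (Γ.Alg k) where
  toFun g := (Γ.autHom k g).toLinearMap
  map_one' := by
    have : Γ.autHom k (1 : G) = AlgHom.id k _ := by
      ext e
      have := Γ.autHom_gen k (1 : G) e
      simpa [gen] using this
    rw [this]; rfl
  map_mul' g h := by
    have : Γ.autHom k (g * h) = (Γ.autHom k g).comp (Γ.autHom k h) := by
      ext e
      have h1 := Γ.autHom_gen k (g * h) e
      have h2 := Γ.autHom_gen k h e
      have h3 := Γ.autHom_gen k g (h • e)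
      simp only [gen] at h1 h2 h3
      simp [h1, h2, h3, mul_smul]
    rw [this]; rfl

theorem component_le_comap [Γ.ActsOn G] (d : ℕ) (g : G) :
    Γ.component k d ≤ (Γ.component k d).comap (Γ.algRep k G g) := by
  refine Submodule.span_le.2 ?_
  rintro _ ⟨l, rfl, rfl⟩
  refine Submodule.subset_span ⟨l.map (g • ·), by simp, ?_⟩
  change Γ.autHom k g _ = _
  simp [map_list_prod, Function.comp_def]

/-- The representation on `A(Γ)_[d]` of a group acting on `Γ`. -/
noncomputable def componentRep (G : Type*) [Group G] [MulAction G V] [MulAction G E] [Γ.ActsOn G]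
    (d : ℕ) : Representation k G (Γ.component k d) :=
  (Γ.algRep k G).subrepresentation (Γ.component k d) (Γ.component_le_comap k d)

end Action

end LayeredGraph

/-- The multiplicity of the irreducible representation `ρ` in the completely reducible
representation `σ`: the number of simple summands of the `ρ`-isotypic component of `σ`. -/
noncomputable def Representation.multiplicity {k G V W : Type*} [Field k] [Group G]
    [AddCommGroup V] [Module k V] [AddCommGroup W] [Module k W]
    (ρ : Representation k G V) (σ : Representation k G W) : ℕ∞ :=
  Module.length k[G] (isotypicComponent k[G] σ.asModule ρ.asModule)

/-! ### The Hasse graph of a polygon -/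

/-- The faces of an `n`-gon: the empty face `star`, the vertices `w i`, the sides `v i` (the side
joining `w i` and `w (i + 1)`), and the polygon `u` itself. Indices are taken modulo `n`. -/
inductive PolygonFace (n : ℕ) : Type
  | star : PolygonFace n
  | w : ZMod n → PolygonFace n
  | v : ZMod n → PolygonFace n
  | u : PolygonFace n

/-- The edges of the Hasse graph of an `n`-gon: `uv i` goes from `u` to `v i`, `vw i` from `v i` to
`w i`, `vw' i` from `v i` to `w (i + 1)`, and `ws i` from `w i` to `star`. -/
inductive PolygonEdge (n : ℕ) : Type
  | uv : ZMod n → PolygonEdge n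
  | vw : ZMod n → PolygonEdge n
  | vw' : ZMod n → PolygonEdge n
  | ws : ZMod n → PolygonEdge n

/-- The Hasse graph `Γ_{D_n}` of an `n`-gon. -/
def polygonGraph (n : ℕ) : LayeredGraph (PolygonFace n) (PolygonEdge n) where
  tail
    | .uv _ => .u
    | .vw i => .v i
    | .vw' i => .v i
    | .ws i => .w i
  head
    | .uv i => .v i
    | .vw i => .w i
    | .vw' i => .w (i + 1)
    | .ws _ => .star
  level
    | .star => 0
    | .w _ => 1
    | .v _ => 2
    | .u => 3
  root := .star
  level_tail := by rintro (i | i | i | i) <;> rfl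
  level_eq_zero_iff := by rintro (_ | i | i | _) <;> simp
  exists_tail := by
    rintro (_ | i | i | _) h
    · exact absurd rfl h
    · exact ⟨.ws i, rfl⟩
    · exact ⟨.vw i, rfl⟩
    · exact ⟨.uv 0, rfl⟩
  level_bounded := ⟨3, by rintro (_ | i | i | _) <;> simp⟩

/-- The action of `D_n` on the faces of the `n`-gon: `r a` is the rotation `w i ↦ w (i + a)`, and
`sr a = s * r a`, where `s` is the reflection `w i ↦ w (3 - i)` fixing the side `v 1` that joins
`w 1` and `w 2`. -/
instance (n : ℕ) : MulAction (DihedralGroup n) (PolygonFace n) where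
  smul
    | .r a, .w i => .w (i + a)
    | .r a, .v i => .v (i + a)
    | .sr a, .w i => .w (3 - (i + a))
    | .sr a, .v i => .v (2 - (i + a))
    | _, .star => .star
    | _, .u => .u
  one_smul := by
    rintro (_ | i | i | _)
    · rfl
    · exact congrArg PolygonFace.w (add_zero i)
    · exact congrArg PolygonFace.v (add_zero i)
    · rfl
  mul_smul := by
    rintro (a | a) (b | b) (_ | i | i | _)
    all_goals first
      | rfl
      | exact congrArg PolygonFace.w (by ring)
      | exact congrArg PolygonFace.v (by ring)

/-- The action of `D_n` on the edges of the Hasse graph; a reflection interchanges the two ends of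
a side. -/
instance (n : ℕ) : MulAction (DihedralGroup n) (PolygonEdge n) where
  smul
    | .r a, .uv i => .uv (i + a)
    | .r a, .vw i => .vw (i + a)
    | .r a, .vw' i => .vw' (i + a)
    | .r a, .ws i => .ws (i + a)
    | .sr a, .uv i => .uv (2 - (i + a))
    | .sr a, .vw i => .vw' (2 - (i + a))
    | .sr a, .vw' i => .vw (2 - (i + a))
    | .sr a, .ws i => .ws (3 - (i + a))
  one_smul := by
    rintro (i | i | i | i)
    · exact congrArg PolygonEdge.uv (add_zero i)
    · exact congrArg PolygonEdge.vw (add_zero i)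
    · exact congrArg PolygonEdge.vw' (add_zero i)
    · exact congrArg PolygonEdge.ws (add_zero i)
  mul_smul := by
    rintro (a | a) (b | b) (i | i | i | i)
    all_goals first
      | exact congrArg PolygonEdge.uv (by ring)
      | exact congrArg PolygonEdge.vw (by ring)
      | exact congrArg PolygonEdge.vw' (by ring)
      | exact congrArg PolygonEdge.ws (by ring)

instance (n : ℕ) : (polygonGraph n).ActsOn (DihedralGroup n) where
  tail_smul := by rintro (a | a) (i | i | i | i) <;> rfl
  head_smul := by
    rintro (a | a) (i | i | i | i)
    all_goals first
      | rfl
      | exact congrArg PolygonFace.w (by ring)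
  level_smul := by rintro (a | a) (_ | i | i | _) <;> rfl

/-- The representation of `D_n` on the component of degree `d` of `A(Γ_{D_n})`. -/
noncomputable abbrev polygonRep (k : Type*) [Field k] (n d : ℕ) :
    Representation k (DihedralGroup n) ((polygonGraph n).component k d) :=
  (polygonGraph n).componentRep k (DihedralGroup n) d

/-- The power series `f` is the graded trace `∑_d Tr(g | A(Γ_{D_n})_[d]) t^d` of `g`. -/
def HasGradedTrace (k : Type*) [Field k] [CharZero k] (n : ℕ) (g : DihedralGroup n)
    (f : ℚ⟦X⟧) : Prop :=
  ∀ d, LinearMap.trace k _ (polygonRep k n d g) = algebraMap ℚ k (PowerSeries.coeff d f)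

/-- The power series `f` is the graded multiplicity `∑_d m_d t^d` of the irreducible representation
`ρ` of `D_n`, where `m_d` is the multiplicity of `ρ` in `A(Γ_{D_n})_[d]`. -/
def HasGradedMultiplicity {k V : Type*} [Field k] [AddCommGroup V] [Module k V] {n : ℕ}
    (ρ : Representation k (DihedralGroup n) V) (f : ℚ⟦X⟧) : Prop :=
  ∀ d, ∃ m : ℕ, ρ.multiplicity (W := (polygonGraph n).component k d) (polygonRep k n d) = m ∧ PowerSeries.coeff d f = m

/-! ### The character table of the dihedral group -/

namespace DihedralChar

variable {n : ℕ}

/-- The trivial character. -/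
def triv : DihedralGroup n → ℤ := fun _ => 1

/-- The character with `r ↦ 1` and `s ↦ -1`. -/
def oneNeg : DihedralGroup n → ℤ
  | .r _ => 1
  | .sr _ => -1

/-- The character with `r ↦ -1` and `s ↦ 1` (for `n` even). -/
def negOne : DihedralGroup n → ℤ
  | .r a => (-1) ^ a.val
  | .sr a => (-1) ^ a.val

/-- The character with `r ↦ -1` and `s ↦ -1` (for `n` even). -/
def negNeg : DihedralGroup n → ℤ
  | .r a => (-1) ^ a.val
  | .sr a => -(-1) ^ a.val

/-- The character with `r ^ a ↦ ζ ^ (j a) + ζ ^ (-j a)` and with value `0` at the reflections, for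
`ζ` a primitive `n`-th root of unity; for `ζ = exp (2 π i / n)` the value at `r ^ a` is
`2 cos (2 π j a / n)`. -/
def two {L : Type*} [Field L] (ζ : L) (j : ℕ) : DihedralGroup n → L
  | .r a => ζ ^ (j * a.val) + (ζ ^ (j * a.val))⁻¹
  | .sr _ => 0

end DihedralChar

/-! ### The power series -/

/-- `a = 1 / (1 - ((2n+1) t - (2n-1) t² + t³))`. -/
noncomputable def seriesA (n : ℕ) : ℚ⟦X⟧ :=
  (1 - (PowerSeries.C (2 * (n : ℚ) + 1) * PowerSeries.X -
    PowerSeries.C (2 * (n : ℚ) - 1) * PowerSeries.X ^ 2 + PowerSeries.X ^ 3))⁻¹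

/-- `b = 1 / (1 - (t + t² + t³))`. -/
noncomputable def seriesB : ℚ⟦X⟧ :=
  (1 - (PowerSeries.X + PowerSeries.X ^ 2 + PowerSeries.X ^ 3))⁻¹

/-- `c = 1 / (1 - (3 t + t² - t³))`. -/
noncomputable def seriesC : ℚ⟦X⟧ :=
  (1 - (3 * PowerSeries.X + PowerSeries.X ^ 2 - PowerSeries.X ^ 3))⁻¹

/-! In `A` the polynomial `(1 + e₁t)⋯(1 + e_mt)` of a path depends only on its end points. Following
paths down to `*` gives each face `x` elements `e(x, d)`, and every edge is `e(tail, 1) - e(head,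
1)`. So `A` is generated by the `e(x, d)` subject to the relations `IsSystem`, obtained by comparing
coefficients along edges.

Read as rewriting rules for `u1 v1`, `u1 v2`, `v1 w` (with `w` an end of `v`), together with a rule
for `u2 w` forced by the overlap `u1 v1 w`, these relations give a normal form. The rewriting
defines left multiplication on the free module on words (`isSystem_mulOp`), hence a representation
of `A`. Acting on the empty word separates the normal words (`wordAction_wordVal`), and evaluating
words in `A` shows that they span (`wordMap_wordAction_prod_gen`). This yields `normalBasis`.

The dihedral group permutes this basis letter by letter, so the trace of `g` in degree `d` counts
the normal words written in letters fixed by `g` (`trace_polygonRep`). A first-letter recursion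
(`series_mul_eq_one`) computes this count from the numbers of fixed sides, fixed vertices and
incident fixed pairs: `n, n, 2n` for the identity, `0, 0, 0` for a nontrivial rotation, and a total
of two fixed sides and vertices with no incidence for a reflection.

The multiplicities follow from the scalar product of characters. It computes `dim Hom(ρ, A_[d])`,
which is the multiplicity because each listed character has norm one, so that `End ρ = k`. -/

/-! ### Path polynomials -/

namespace LayeredGraph

variable {V E : Type*} {Γ : LayeredGraph V E}

theorem pathElem_zero (k : Type*) [Field k] (π : List E) : pathElem k π 0 = 1 := by
  simp [pathElem]

theorem pathElem_cons_succ (k : Type*) [Field k] (e : E) (π : List E) (d : ℕ) :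
    pathElem k (e :: π) (d + 1) = pathElem k π (d + 1) + FreeAlgebra.ι k e * pathElem k π d := by
  simp [pathElem, List.sublistsLen_succ_cons, Function.comp_def, List.sum_map_mul_left]

theorem pathElem_eq_zero (k : Type*) [Field k] {π : List E} {d : ℕ} (h : π.length < d) :
    pathElem k π d = 0 := by
  simp [pathElem, List.sublistsLen_of_length_lt h]

theorem IsPath.level_eq {v w : V} {π : List E} (h : Γ.IsPath v π w) :
    Γ.level v = π.length + Γ.level w := by
  induction π generalizing v with
  | nil => cases h; simp
  | cons e π ih => rw [← h.1, Γ.level_tail, ih h.2, List.length_cons]; omega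

section PathSeries

variable {S : Type*} [Ring S]

/-- The noncommutative generating polynomial `(1 + x_{e₁} t) ⋯ (1 + x_{e_m} t)` of a path. -/
noncomputable def pathSeries (x : E → S) (π : List E) : S⟦X⟧ :=
  (π.map fun e => 1 + PowerSeries.C (x e) * PowerSeries.X).prod

/-- Since `t` is central, expanding the product chooses edges in their order along the path, that
is, a sublist. -/
theorem coeff_pathSeries {k : Type*} [Field k] [Algebra k S] (x : E → S) (π : List E) (d : ℕ) :
    PowerSeries.coeff d (pathSeries x π) = FreeAlgebra.lift k x (pathElem k π d) := by
  induction π generalizing d with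
  | nil => cases d <;> simp [pathSeries, pathElem, PowerSeries.coeff_one]
  | cons e π ih =>
    have hc : pathSeries x (e :: π) =
        pathSeries x π + PowerSeries.C (x e) * (PowerSeries.X * pathSeries x π) := by
      simp [pathSeries, add_mul, mul_assoc]
    cases d with
    | zero => rw [hc]; simpa [pathElem_zero] using ih 0
    | succ d =>
      rw [hc, map_add, PowerSeries.coeff_C_mul, PowerSeries.coeff_succ_X_mul, ih, ih,
        pathElem_cons_succ]
      simp

/-- The factors telescope along the path. -/
theorem pathSeries_mul_of_isPath (x : E → S) (F : V → S⟦X⟧)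
    (hF : ∀ e, F (Γ.tail e) = (1 + PowerSeries.C (x e) * PowerSeries.X) * F (Γ.head e))
    {v w : V} {π : List E} (h : Γ.IsPath v π w) : pathSeries x π * F w = F v := by
  induction π generalizing v with
  | nil => cases h; simp [pathSeries]
  | cons e π ih =>
    rw [← h.1, hF, ← ih h.2]
    simp [pathSeries, mul_assoc]

/-- To define a homomorphism on `A(Γ)` it suffices to give a family of power series with invertible
constant terms, indexed by the vertices, which is compatible with the edges. -/
theorem exists_algHom {k : Type*} [Field k] [Algebra k S] (x : E → S) (F : V → S⟦X⟧)
    (hF : ∀ e, F (Γ.tail e) = (1 + PowerSeries.C (x e) * PowerSeries.X) * F (Γ.head e))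
    (hu : ∀ v, IsUnit (F v)) :
    ∃ φ : Γ.Alg k →ₐ[k] S, ∀ e, φ (Γ.gen k e) = x e := by
  have hrel : ∀ ⦃a b⦄, Γ.Rel k a b → FreeAlgebra.lift k x a = FreeAlgebra.lift k x b := by
    rintro _ _ ⟨v, w, π₁, π₂, d, h₁, h₂, -, -, rfl, rfl⟩
    rw [← coeff_pathSeries, ← coeff_pathSeries]
    congr 1
    -- Both path polynomials, multiplied by the unit `F w`, equal `F v`.
    refine (hu w).mul_left_injective ?_
    simp only [pathSeries_mul_of_isPath x F hF h₁, pathSeries_mul_of_isPath x F hF h₂]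
  exact ⟨RingQuot.liftAlgHom k ⟨FreeAlgebra.lift k x, hrel⟩, fun e => by simp [gen]⟩

end PathSeries

/-- The image of `e(π, d)` in `A(Γ)`. -/
noncomputable def pathCoeff (Γ : LayeredGraph V E) (k : Type*) [Field k] (π : List E) (d : ℕ) :
    Γ.Alg k :=
  RingQuot.mkAlgHom k (Γ.Rel k) (pathElem k π d)

variable {k : Type*} [Field k]

theorem pathCoeff_zero (π : List E) : Γ.pathCoeff k π 0 = 1 := by
  simp [pathCoeff, pathElem_zero]

theorem pathCoeff_eq_zero {π : List E} {d : ℕ} (h : π.length < d) : Γ.pathCoeff k π d = 0 := by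
  simp [pathCoeff, pathElem_eq_zero k h]

theorem pathCoeff_cons_succ (e : E) (π : List E) (d : ℕ) :
    Γ.pathCoeff k (e :: π) (d + 1) =
      Γ.pathCoeff k π (d + 1) + Γ.gen k e * Γ.pathCoeff k π d := by
  simp [pathCoeff, pathElem_cons_succ, gen]

/-- Levels force the two lengths to agree, so in the degrees outside the defining relations both
sides are `1` or both are `0`. -/
theorem IsPath.pathCoeff_eq {v w : V} {π₁ π₂ : List E} (h₁ : Γ.IsPath v π₁ w)
    (h₂ : Γ.IsPath v π₂ w) (d : ℕ) : Γ.pathCoeff k π₁ d = Γ.pathCoeff k π₂ d := by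
  have hl : π₁.length = π₂.length := by have := h₁.level_eq; have := h₂.level_eq; omega
  rcases Nat.eq_zero_or_pos d with rfl | hd
  · simp [pathCoeff_zero]
  by_cases hd' : d ≤ π₁.length
  · exact RingQuot.mkAlgHom_rel k ⟨v, w, π₁, π₂, d, h₁, h₂, hd, hd', rfl, rfl⟩
  · rw [pathCoeff_eq_zero (by omega), pathCoeff_eq_zero (by omega)]

theorem autHom_pathCoeff {G : Type*} [Group G] [MulAction G V] [MulAction G E] [Γ.ActsOn G]
    (g : G) (π : List E) (d : ℕ) :
    Γ.autHom k g (Γ.pathCoeff k π d) = Γ.pathCoeff k (π.map (g • ·)) d := by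
  have key : (Γ.autHom k g).comp (RingQuot.mkAlgHom k (Γ.Rel k)) =
      (RingQuot.mkAlgHom k (Γ.Rel k)).comp
        (FreeAlgebra.lift k fun e => FreeAlgebra.ι k (g • e)) := by
    ext e; simpa [gen] using Γ.autHom_gen k g e
  have := DFunLike.congr_fun key (pathElem k π d)
  simpa [lift_pathElem, pathCoeff] using this

theorem gen_mem_component (e : E) : Γ.gen k e ∈ Γ.component k 1 :=
  Submodule.subset_span ⟨[e], rfl, by simp⟩

theorem one_mem_component : (1 : Γ.Alg k) ∈ Γ.component k 0 :=
  Submodule.subset_span ⟨[], rfl, by simp⟩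

theorem mul_mem_component {a b : Γ.Alg k} {i j : ℕ} (ha : a ∈ Γ.component k i)
    (hb : b ∈ Γ.component k j) : a * b ∈ Γ.component k (i + j) := by
  have : a * b ∈ Γ.component k i * Γ.component k j := Submodule.mul_mem_mul ha hb
  rw [component, component, Submodule.span_mul_span] at this
  refine Submodule.span_mono ?_ this
  rintro _ ⟨_, ⟨l, rfl, rfl⟩, _, ⟨l', rfl, rfl⟩, rfl⟩
  exact ⟨l ++ l', by simp, by simp⟩

theorem pathCoeff_mem_component (π : List E) (d : ℕ) : Γ.pathCoeff k π d ∈ Γ.component k d := by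
  induction π generalizing d with
  | nil =>
    cases d with
    | zero => rw [pathCoeff_zero]; exact one_mem_component
    | succ d => rw [pathCoeff_eq_zero (by simp)]; exact zero_mem _
  | cons e π ih =>
    cases d with
    | zero => rw [pathCoeff_zero]; exact one_mem_component
    | succ d =>
      rw [pathCoeff_cons_succ]
      refine add_mem (ih _) ?_
      rw [add_comm d]
      exact mul_mem_component (gen_mem_component e) (ih d)

end LayeredGraph

/-! ### The homogeneous generators of `A(Γ_{D_n})` -/

/-- The generators `e(x, d)` of `A(Γ_{D_n})`, for a face `x` of positive level and
`1 ≤ d ≤ level x`. -/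
inductive PolygonLetter (n : ℕ) : Type
  | u1 : PolygonLetter n
  | u2 : PolygonLetter n
  | u3 : PolygonLetter n
  | v1 : ZMod n → PolygonLetter n
  | v2 : ZMod n → PolygonLetter n
  | w : ZMod n → PolygonLetter n

namespace PolygonLetter

variable {n : ℕ}

/-- The degree `d` of the generator `e(x, d)`. -/
def deg : PolygonLetter n → ℕ
  | u1 => 1
  | u2 => 2
  | u3 => 3
  | v1 _ => 1
  | v2 _ => 2
  | w _ => 1

instance : MulAction (DihedralGroup n) (PolygonLetter n) where
  smul
    | .r a, .w i => .w (i + a)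
    | .r a, .v1 i => .v1 (i + a)
    | .r a, .v2 i => .v2 (i + a)
    | .sr a, .w i => .w (3 - (i + a))
    | .sr a, .v1 i => .v1 (2 - (i + a))
    | .sr a, .v2 i => .v2 (2 - (i + a))
    | _, .u1 => .u1
    | _, .u2 => .u2
    | _, .u3 => .u3
  one_smul := by
    rintro (_ | _ | _ | i | i | i)
    · rfl
    · rfl
    · rfl
    · exact congrArg v1 (add_zero i)
    · exact congrArg v2 (add_zero i)
    · exact congrArg w (add_zero i)
  mul_smul := by
    rintro (a | a) (b | b) (_ | _ | _ | i | i | i)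
    all_goals first
      | rfl
      | exact congrArg v1 (by ring)
      | exact congrArg v2 (by ring)
      | exact congrArg w (by ring)

/-- The pairs of generators whose product is rewritten to bring an element of `A(Γ_{D_n})` into
normal form. -/
def Reducible : PolygonLetter n → PolygonLetter n → Prop
  | u1, v1 _ => True
  | u1, v2 _ => True
  | u2, w _ => True
  | v1 i, w j => j = i ∨ j = i + 1
  | _, _ => False

/-- The relations between the generators `e(x, d)`. -/
structure IsSystem {S : Type*} [Ring S] (X : PolygonLetter n → S) : Prop where
  u1_v1 : ∀ i, X u1 * X (v1 i) = X u2 + X (v1 i) * X (v1 i) - X (v2 i)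
  u1_v2 : ∀ i, X u1 * X (v2 i) = X u3 + X (v1 i) * X (v2 i)
  v1_w : ∀ i j, j = i ∨ j = i + 1 → X (v1 i) * X (w j) = X (v2 i) + X (w j) * X (w j)

/-- The two ways of evaluating `u1 * v1 i * w i` give this rule; it is the only new consequence that
the normal form needs. -/
theorem IsSystem.u2_w {S : Type*} [Ring S] {X : PolygonLetter n → S} (h : IsSystem X)
    (i : ZMod n) :
    X u2 * X (w i) = X u3 + X u1 * (X (w i) * X (w i)) - X (w i) * (X (w i) * X (w i)) := by
  have h2 : X u2 = X u1 * X (v1 i) - X (v1 i) * X (v1 i) + X (v2 i) := by rw [h.u1_v1 i]; abel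
  have h3 : X u3 = X u1 * X (v2 i) - X (v1 i) * X (v2 i) := by rw [h.u1_v2 i]; abel
  have hw := h.v1_w i i (Or.inl rfl)
  rw [h2, h3, add_mul, sub_mul, mul_assoc, mul_assoc, hw, mul_add, mul_add, ← mul_assoc (X (v1 i)),
    hw, add_mul, mul_assoc (X (w i))]
  abel

/-- The value `e(x, 1)` of a face. -/
def faceVal {S : Type*} [Ring S] (X : PolygonLetter n → S) : PolygonFace n → S
  | .star => 0
  | .w i => X (w i)
  | .v i => X (v1 i)
  | .u => X u1

/-- The value `e(tail, 1) - e(head, 1)` of an edge. -/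
def edgeVal {S : Type*} [Ring S] (X : PolygonLetter n → S) (e : PolygonEdge n) : S :=
  faceVal X ((polygonGraph n).tail e) - faceVal X ((polygonGraph n).head e)

open PowerSeries in
/-- The generating polynomial `1 + ∑_d e(x, d) t^d` of a face. -/
noncomputable def faceSeries {S : Type*} [Ring S] (Y : PolygonLetter n → S) :
    PolygonFace n → S⟦X⟧
  | .star => 1
  | .w i => 1 + C (Y (w i)) * X
  | .v i => 1 + C (Y (v1 i)) * X + C (Y (v2 i)) * X ^ 2
  | .u => 1 + C (Y u1) * X + C (Y u2) * X ^ 2 + C (Y u3) * X ^ 3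

/-- The linear coefficients agree by the choice of `edgeVal`; the higher ones are the relations of
`IsSystem`. -/
theorem IsSystem.faceSeries_tail {S : Type*} [Ring S] {X : PolygonLetter n → S} (h : IsSystem X)
    (e : PolygonEdge n) :
    faceSeries X ((polygonGraph n).tail e) =
      (1 + PowerSeries.C (edgeVal X e) * PowerSeries.X) *
        faceSeries X ((polygonGraph n).head e) := by
  -- `S` is not commutative: `t` is moved to the right of all constants so that `abel` can compare
  -- monomials.
  have hX : ∀ a : S, (PowerSeries.X : S⟦X⟧) * PowerSeries.C a = PowerSeries.C a * PowerSeries.X :=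
    fun a => (PowerSeries.commute_X _).symm
  have hX' : ∀ (a : S) (b : S⟦X⟧), (PowerSeries.X : S⟦X⟧) * (PowerSeries.C a * b) =
      PowerSeries.C a * (PowerSeries.X * b) := fun a b => by rw [← mul_assoc, hX, mul_assoc]
  have h2 : ∀ i, X u2 = X u1 * X (v1 i) - X (v1 i) * X (v1 i) + X (v2 i) := fun i => by
    rw [h.u1_v1 i]; abel
  have h3 : ∀ i, X u3 = X u1 * X (v2 i) - X (v1 i) * X (v2 i) := fun i => by rw [h.u1_v2 i]; abel
  have hv : ∀ i j, j = i ∨ j = i + 1 → X (v2 i) = X (v1 i) * X (w j) - X (w j) * X (w j) :=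
    fun i j hj => by rw [h.v1_w i j hj]; abel
  rcases e with i | i | i | i <;> simp only [polygonGraph, edgeVal, faceVal, faceSeries]
  · rw [h2 i, h3 i]
    simp only [map_add, map_sub, map_mul, pow_succ, pow_zero, one_mul, mul_add, add_mul, sub_mul,
      mul_one, mul_assoc, hX']
    abel
  · rw [hv i i (Or.inl rfl)]
    simp only [map_sub, map_mul, pow_succ, pow_zero, one_mul, mul_add, add_mul, sub_mul,
      mul_one, mul_assoc, hX']
    abel
  · rw [hv i (i + 1) (Or.inr rfl)]
    simp only [map_sub, map_mul, pow_succ, pow_zero, one_mul, mul_add, add_mul, sub_mul,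
      mul_one, mul_assoc, hX']
    abel
  · simp

theorem isUnit_faceSeries {S : Type*} [Ring S] (X : PolygonLetter n → S) (a : PolygonFace n) :
    IsUnit (faceSeries X a) := by
  rw [PowerSeries.isUnit_iff_constantCoeff]
  rcases a with _ | i | i | _ <;> simp [faceSeries]

theorem IsSystem.exists_algHom {k : Type*} [Field k] {S : Type*} [Ring S] [Algebra k S]
    {X : PolygonLetter n → S} (h : IsSystem X) :
    ∃ φ : (polygonGraph n).Alg k →ₐ[k] S, ∀ e, φ ((polygonGraph n).gen k e) = edgeVal X e :=
  LayeredGraph.exists_algHom _ (faceSeries X) h.faceSeries_tail (isUnit_faceSeries X)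

/-! #### The generators as elements of the algebra -/

/-- A path from a face to the empty face. -/
def facePath : PolygonFace n → List (PolygonEdge n)
  | .star => []
  | .w i => [.ws i]
  | .v i => [.vw i, .ws i]
  | .u => [.uv 0, .vw 0, .ws 0]

theorem isPath_facePath (a : PolygonFace n) : (polygonGraph n).IsPath a (facePath a) .star := by
  rcases a with _ | i | i | _ <;> simp [facePath, polygonGraph, LayeredGraph.IsPath]

/-- The face `x` of the generator `e(x, d)`. -/
def face : PolygonLetter n → PolygonFace n
  | u1 => .u
  | u2 => .u
  | u3 => .u
  | v1 i => .v i
  | v2 i => .v i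
  | w i => .w i

variable (k : Type*) [Field k]

/-- The generator `e(x, d)` as an element of `A(Γ_{D_n})`. -/
noncomputable def val (x : PolygonLetter n) : (polygonGraph n).Alg k :=
  (polygonGraph n).pathCoeff k (facePath x.face) x.deg

theorem val_mem_component (x : PolygonLetter n) : x.val k ∈ (polygonGraph n).component k x.deg :=
  LayeredGraph.pathCoeff_mem_component _ _

theorem face_smul (g : DihedralGroup n) (x : PolygonLetter n) : (g • x).face = g • x.face := by
  rcases g with a | a <;> rcases x with _ | _ | _ | i | i | i <;> rfl

theorem deg_smul (g : DihedralGroup n) (x : PolygonLetter n) : (g • x).deg = x.deg := by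
  rcases g with a | a <;> rcases x with _ | _ | _ | i | i | i <;> rfl

/-- The translate of `facePath x.face` need not be the chosen path of the translated face, but it
has the same end points. -/
theorem autHom_val (g : DihedralGroup n) (x : PolygonLetter n) :
    (polygonGraph n).autHom k g (x.val k) = (g • x).val k := by
  rw [val, LayeredGraph.autHom_pathCoeff, val, deg_smul, face_smul]
  refine LayeredGraph.IsPath.pathCoeff_eq (v := g • x.face) (w := .star) ?_ (isPath_facePath _) _
  have := LayeredGraph.IsPath.smul _ g (isPath_facePath x.face)
  rcases g with a | a <;> exact this

theorem pathCoeff_facePath_tail (e : PolygonEdge n) (d : ℕ) :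
    (polygonGraph n).pathCoeff k (facePath ((polygonGraph n).tail e)) d =
      (polygonGraph n).pathCoeff k (e :: facePath ((polygonGraph n).head e)) d :=
  (isPath_facePath ((polygonGraph n).tail e)).pathCoeff_eq
    (show (polygonGraph n).IsPath _ (e :: _) _ from ⟨rfl, isPath_facePath _⟩) d

theorem gen_eq_edgeVal (e : PolygonEdge n) : (polygonGraph n).gen k e = edgeVal (val k) e := by
  have h := pathCoeff_facePath_tail k e 1
  rw [LayeredGraph.pathCoeff_cons_succ, LayeredGraph.pathCoeff_zero, mul_one, zero_add] at h
  have key : ∀ a : PolygonFace n,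
      (polygonGraph n).pathCoeff k (facePath a) 1 = faceVal (val k) a := by
    rintro (_ | i | i | _)
    · exact LayeredGraph.pathCoeff_eq_zero (by simp [facePath])
    all_goals rfl
  rw [edgeVal, ← key, ← key, h]
  abel

/-- Each relation is one coefficient of `e(tail) = (1 + e t) e(head)`; coefficients beyond the
length of the lower path vanish. -/
theorem isSystem_val : IsSystem (val (n := n) k) := by
  have h : ∀ (e : PolygonEdge n) (d : ℕ),
      (polygonGraph n).pathCoeff k (facePath ((polygonGraph n).tail e)) (d + 1) =
        (polygonGraph n).pathCoeff k (facePath ((polygonGraph n).head e)) (d + 1) +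
          edgeVal (val k) e *
            (polygonGraph n).pathCoeff k (facePath ((polygonGraph n).head e)) d := fun e d => by
    rw [pathCoeff_facePath_tail, LayeredGraph.pathCoeff_cons_succ, gen_eq_edgeVal]
  refine ⟨fun i => ?_, fun i => ?_, fun i j hj => ?_⟩
  · have : val k u2 = val k (v2 i) + (val k u1 - val k (v1 i)) * val k (v1 i) := h (.uv i) 1
    rw [this, sub_mul]
    abel
  · have : val k u3 = _ + (val k u1 - val k (v1 i)) * val k (v2 i) := h (.uv i) 2
    rw [this, sub_mul, LayeredGraph.pathCoeff_eq_zero (by simp [facePath, polygonGraph])]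
    abel
  · have : val k (v2 i) = (polygonGraph n).pathCoeff k (facePath (.w j)) 2 +
        (val k (v1 i) - val k (w j)) * val k (w j) := by
      rcases hj with rfl | rfl
      · exact h (.vw j) 1
      · exact h (.vw' i) 1
    rw [this, sub_mul, LayeredGraph.pathCoeff_eq_zero (by simp [facePath])]
    abel

end PolygonLetter

/-! ### The basis of normal words -/

namespace PolygonLetter

variable {n : ℕ}

/-- A word in the generators `e(x, d)` is normal if none of its subwords of length two is
rewritten. -/
def IsNormal (l : List (PolygonLetter n)) : Prop :=
  l.IsChain fun x y => ¬ Reducible x y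

/-- The degree of a word. -/
def wordDeg (l : List (PolygonLetter n)) : ℕ :=
  (l.map deg).sum

/-! ### Rewriting operators on the module of all words -/

section

variable (k : Type*) [Field k]

/-- The product of a generator and a word, in normal form if the word is normal. -/
noncomputable def mulWord : PolygonLetter n → List (PolygonLetter n) →
    (List (PolygonLetter n) →₀ k)
  | v1 i, w j :: l =>
    if j = i ∨ j = i + 1 then .single (v2 i :: l) 1 + .single (w j :: w j :: l) 1
    else .single (v1 i :: w j :: l) 1
  | u2, w j :: l =>
    .single (u3 :: l) 1 + .single (u1 :: w j :: w j :: l) 1 - .single (w j :: w j :: w j :: l) 1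
  -- Rewriting `u1 v1` produces `u2 w j`, which is rewritten again at once. The clause also covers
  -- the case where `w j` is an end of `v i`, since the operators act on non-normal words too.
  | u1, v1 i :: w j :: l =>
    .single (u3 :: l) 1 + .single (u1 :: w j :: w j :: l) 1 - .single (w j :: w j :: w j :: l) 1 +
      .single (v1 i :: v1 i :: w j :: l) 1 - .single (v2 i :: w j :: l) 1
  | u1, v1 i :: l =>
    .single (u2 :: l) 1 + .single (v1 i :: v1 i :: l) 1 - .single (v2 i :: l) 1
  | u1, v2 i :: l => .single (u3 :: l) 1 + .single (v1 i :: v2 i :: l) 1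
  | x, l => .single (x :: l) 1

/-- The operator of left multiplication by a generator. -/
noncomputable def mulOp (x : PolygonLetter n) : Module.End k (List (PolygonLetter n) →₀ k) :=
  Finsupp.linearCombination k (mulWord k x)

@[simp]
theorem mulOp_single (x : PolygonLetter n) (l : List (PolygonLetter n)) :
    mulOp k x (.single l 1) = mulWord k x l := by
  simp [mulOp]

/-- This is the confluence check. The only overlap of two rules is `u1 v1 w`; it is resolved in the
first relation, when `w j` is an end of `v i`. -/
theorem isSystem_mulOp : IsSystem (mulOp (n := n) k) := by
  refine ⟨fun i => ?_, fun i => ?_, fun i j hj => ?_⟩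
  · refine Finsupp.lhom_ext' fun l => LinearMap.ext_ring ?_
    rcases l with _ | ⟨_ | _ | _ | j | j | j, l⟩
    case cons.w =>
      by_cases hj : j = i ∨ j = i + 1
      · simp [mulWord, hj]; abel
      · simp [mulWord, hj]
    all_goals simp [mulWord]
  · refine Finsupp.lhom_ext' fun l => LinearMap.ext_ring ?_
    rcases l with _ | ⟨_ | _ | _ | j | j | j, l⟩ <;> simp [mulWord]
  · refine Finsupp.lhom_ext' fun l => LinearMap.ext_ring ?_
    simp [mulWord, hj]

theorem mulWord_eq_single {x : PolygonLetter n} {l : List (PolygonLetter n)}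
    (h : IsNormal (x :: l)) : mulWord k x l = .single (x :: l) 1 := by
  rcases x with _ | _ | _ | i | i | i <;> rcases l with _ | ⟨_ | _ | _ | j | j | j, l⟩ <;>
    simp_all [mulWord, IsNormal, Reducible]

/-- The span of the normal words of degree `d`. -/
noncomputable def normalSpan (n d : ℕ) : Submodule k (List (PolygonLetter n) →₀ k) :=
  Finsupp.supported k k {l | IsNormal l ∧ wordDeg l = d}

/-- One application of `mulWord` suffices: `u3`, `v2` and `w` start no reducible pair, and the pairs
`v1 v1`, `v1 v2` and `u1 w` are irreducible. All rules are homogeneous. -/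
theorem mulWord_mem_normalSpan (x : PolygonLetter n) {l : List (PolygonLetter n)}
    (h : IsNormal l) : mulWord k x l ∈ normalSpan k n (x.deg + wordDeg l) := by
  by_cases hx : IsNormal (x :: l)
  · rw [mulWord_eq_single k hx]
    exact Finsupp.single_mem_supported _ _ ⟨hx, by simp [wordDeg]⟩
  have hs : ∀ {d : ℕ} {l : List (PolygonLetter n)}, IsNormal l → wordDeg l = d →
      Finsupp.single l 1 ∈ normalSpan k n d := fun h1 h2 =>
    Finsupp.single_mem_supported _ _ ⟨h1, h2⟩
  rcases l with _ | ⟨y, l⟩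
  · exact absurd (List.isChain_singleton x) hx
  have hr : Reducible x y := by
    by_contra hr
    exact hx (List.isChain_cons_cons.2 ⟨hr, h⟩)
  have hl : IsNormal l := h.tail
  have cons : ∀ {x y : PolygonLetter n} {l}, ¬ Reducible x y → IsNormal (y :: l) →
      IsNormal (x :: y :: l) := fun h1 h2 => List.isChain_cons_cons.2 ⟨h1, h2⟩
  have free : ∀ {x : PolygonLetter n} {l}, (∀ y, ¬ Reducible x y) → IsNormal l →
      IsNormal (x :: l) := fun {x l} hy hl => by
    rcases l with _ | ⟨y, l⟩
    · exact List.isChain_singleton _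
    · exact cons (hy y) hl
  rcases x with _ | _ | _ | i | i | i <;> rcases y with _ | _ | _ | j | j | j <;>
    simp only [Reducible] at hr
  · have h2 : IsNormal (v1 j :: v1 j :: l) := cons id h
    have h3 : IsNormal (v2 j :: l) := free (fun _ => id) hl
    rcases l with _ | ⟨_ | _ | _ | i | i | i, l⟩
    case cons.w =>
      exact sub_mem (add_mem (sub_mem (add_mem
        (hs (free (fun _ => id) hl.tail) (by simp [wordDeg, deg]; omega))
        (hs (cons id (cons id hl)) (by simp [wordDeg, deg])))
        (hs (cons id (cons id hl)) (by simp [wordDeg, deg])))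
        (hs h2 (by simp [wordDeg, deg]))) (hs h3 (by simp [wordDeg, deg]; omega))
    -- Here `l` does not begin with a `w`, so `u2 :: l` is normal.
    all_goals
      refine sub_mem (add_mem (hs ?_ (by simp [wordDeg, deg]; try omega))
        (hs h2 (by simp [wordDeg, deg]))) (hs h3 (by simp [wordDeg, deg]; try omega))
    · exact List.isChain_singleton _
    all_goals exact cons id hl
  · exact add_mem (hs (free (fun _ => id) hl) (by simp [wordDeg, deg]; omega))
      (hs (cons id h) (by simp [wordDeg, deg]))
  · exact sub_mem (add_mem (hs (free (fun _ => id) hl) (by simp [wordDeg, deg]; omega))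
      (hs (cons id (cons id h)) (by simp [wordDeg, deg]; omega)))
      (hs (cons id (cons id h)) (by simp [wordDeg, deg]; omega))
  · simp only [mulWord, if_pos hr]
    exact add_mem (hs (free (fun _ => id) hl) (by simp [wordDeg, deg]; omega))
      (hs (cons id h) (by simp [wordDeg, deg]))

theorem mulOp_mem_normalSpan (x : PolygonLetter n) {d : ℕ} {m : List (PolygonLetter n) →₀ k}
    (h : m ∈ normalSpan k n d) : mulOp k x m ∈ normalSpan k n (x.deg + d) := by
  rw [normalSpan, Finsupp.supported_eq_span_single] at h
  induction h using Submodule.span_induction with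
  | mem _ h =>
    obtain ⟨l, ⟨hl, rfl⟩, rfl⟩ := h
    rw [mulOp_single]
    exact mulWord_mem_normalSpan k x hl
  | zero => rw [map_zero]; exact zero_mem _
  | add _ _ _ _ h1 h2 => rw [map_add]; exact add_mem h1 h2
  | smul a _ _ h => rw [map_smul]; exact Submodule.smul_mem _ a h

/-! ### Comparison of the module of words with the algebra -/

/-- The element of `A(Γ_{D_n})` given by a word. -/
noncomputable def wordVal (l : List (PolygonLetter n)) : (polygonGraph n).Alg k :=
  (l.map (val k)).prod

theorem wordVal_mem_component (l : List (PolygonLetter n)) :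
    wordVal k l ∈ (polygonGraph n).component k (wordDeg l) := by
  induction l with
  | nil => exact LayeredGraph.one_mem_component
  | cons x l ih => exact LayeredGraph.mul_mem_component (val_mem_component k x) ih

theorem autHom_wordVal (g : DihedralGroup n) (l : List (PolygonLetter n)) :
    (polygonGraph n).autHom k g (wordVal k l) = wordVal k (l.map (g • ·)) := by
  simp [wordVal, map_list_prod, Function.comp_def, autHom_val]

/-- The linear map from the free module on the words to `A(Γ_{D_n})`. -/
noncomputable def wordMap : (List (PolygonLetter n) →₀ k) →ₗ[k] (polygonGraph n).Alg k :=
  Finsupp.linearCombination k (wordVal k)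

@[simp]
theorem wordMap_single (l : List (PolygonLetter n)) :
    wordMap k (.single l 1) = wordVal k l := by
  simp [wordMap]

theorem wordMap_mulWord (x : PolygonLetter n) (l : List (PolygonLetter n)) :
    wordMap k (mulWord k x l) = x.val k * wordVal k l := by
  have h := isSystem_val (n := n) k
  have hc : ∀ (x : PolygonLetter n) l, wordVal k (x :: l) = x.val k * wordVal k l := fun x l => by
    simp [wordVal]
  have h1 : ∀ i a, val k u1 * (val k (v1 i) * a) =
      val k u2 * a + val k (v1 i) * (val k (v1 i) * a) - val k (v2 i) * a := fun i a => by
    rw [← mul_assoc, h.u1_v1, sub_mul, add_mul, mul_assoc]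
  have h2 : ∀ i a, val k u1 * (val k (v2 i) * a) =
      val k u3 * a + val k (v1 i) * (val k (v2 i) * a) := fun i a => by
    rw [← mul_assoc, h.u1_v2, add_mul, mul_assoc]
  have h3 : ∀ i a, val k u2 * (val k (w i) * a) = val k u3 * a +
      val k u1 * (val k (w i) * (val k (w i) * a)) -
      val k (w i) * (val k (w i) * (val k (w i) * a)) := fun i a => by
    rw [← mul_assoc, h.u2_w]; simp only [sub_mul, add_mul, mul_assoc]
  rcases x with _ | _ | _ | i | i | i
  · rcases l with _ | ⟨_ | _ | _ | j | j | j, l⟩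
    case cons.v1 =>
      rcases l with _ | ⟨_ | _ | _ | i | i | i, l⟩ <;>
        simp only [mulWord, map_add, map_sub, wordMap_single, hc, h1, h3]
    case cons.v2 => simp only [mulWord, map_add, wordMap_single, hc, h2]
    all_goals simp [mulWord, hc]
  · rcases l with _ | ⟨_ | _ | _ | j | j | j, l⟩
    case cons.w => simp only [mulWord, map_add, map_sub, wordMap_single, hc, h3]
    all_goals simp [mulWord, hc]
  · simp [mulWord, hc]
  · rcases l with _ | ⟨_ | _ | _ | j | j | j, l⟩
    case cons.w =>
      by_cases hj : j = i ∨ j = i + 1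
      · simp only [mulWord, if_pos hj, map_add, wordMap_single, hc]
        rw [← mul_assoc (val k (v1 i)), h.v1_w i j hj, add_mul, mul_assoc]
      · simp [mulWord, if_neg hj, hc]
    all_goals simp [mulWord, hc]
  · simp [mulWord, hc]
  · simp [mulWord, hc]

theorem wordMap_mulOp (x : PolygonLetter n) (m : List (PolygonLetter n) →₀ k) :
    wordMap k (mulOp k x m) = x.val k * wordMap k m := by
  have : (wordMap k).comp (mulOp k x) = (LinearMap.mulLeft k (x.val k)).comp (wordMap k) :=
    Finsupp.lhom_ext' fun l => LinearMap.ext_ring (by simp [wordMap_mulWord])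
  exact LinearMap.congr_fun this m

/-- The representation of `A(Γ_{D_n})` on the free module on the words. -/
noncomputable def wordAction :
    (polygonGraph n).Alg k →ₐ[k] Module.End k (List (PolygonLetter n) →₀ k) :=
  (isSystem_mulOp k).exists_algHom.choose

theorem wordAction_gen (e : PolygonEdge n) :
    wordAction k ((polygonGraph n).gen k e) = edgeVal (mulOp k) e :=
  (isSystem_mulOp k).exists_algHom.choose_spec e

/-- The edges determine the `e(x, 1)` by climbing from `*`; the relations can then be solved for
`v2`, `u2` and `u3`. -/
theorem IsSystem.map_val {S : Type*} [Ring S] [Algebra k S] {X : PolygonLetter n → S}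
    (h : IsSystem X) (φ : (polygonGraph n).Alg k →ₐ[k] S)
    (hφ : ∀ e, φ ((polygonGraph n).gen k e) = edgeVal X e) (x : PolygonLetter n) :
    φ (x.val k) = X x := by
  have hv := isSystem_val (n := n) k
  have hw : ∀ i, φ (val k (w i)) = X (w i) := fun i => by
    have := hφ (.ws i)
    rw [gen_eq_edgeVal, edgeVal, map_sub] at this
    change φ (val k (w i)) - φ 0 = X (w i) - 0 at this
    rwa [map_zero, sub_zero, sub_zero] at this
  have hv1 : ∀ i, φ (val k (v1 i)) = X (v1 i) := fun i => by
    have := hφ (.vw i)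
    rw [gen_eq_edgeVal, edgeVal, map_sub] at this
    change φ (val k (v1 i)) - φ (val k (w i)) = X (v1 i) - X (w i) at this
    rwa [hw, sub_left_inj] at this
  have hu1 : φ (val k u1) = X u1 := by
    have := hφ (.uv 0)
    rw [gen_eq_edgeVal, edgeVal, map_sub] at this
    change φ (val k u1) - φ (val k (v1 0)) = X u1 - X (v1 0) at this
    rwa [hv1, sub_left_inj] at this
  have hv2 : ∀ i, φ (val k (v2 i)) = X (v2 i) := fun i => by
    have := congrArg φ (hv.v1_w i i (Or.inl rfl))
    rw [map_mul, map_add, map_mul, hv1, hw, h.v1_w i i (Or.inl rfl)] at this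
    exact (add_right_cancel this).symm
  have hu2 : φ (val k u2) = X u2 := by
    have := congrArg φ (hv.u1_v1 0)
    rw [map_mul, map_sub, map_add, map_mul, hu1, hv1, hv2, h.u1_v1 0] at this
    exact (add_right_cancel (sub_left_injective this)).symm
  have hu3 : φ (val k u3) = X u3 := by
    have := congrArg φ (hv.u1_v2 0)
    rw [map_mul, map_add, map_mul, hu1, hv1, hv2, h.u1_v2 0] at this
    exact (add_right_cancel this).symm
  rcases x with _ | _ | _ | i | i | i
  exacts [hu1, hu2, hu3, hv1 i, hv2 i, hw i]

theorem wordAction_val (x : PolygonLetter n) : wordAction k (x.val k) = mulOp k x :=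
  (isSystem_mulOp k).map_val k _ (wordAction_gen k) x

/-- A normal word is built from the empty word without any rewriting; this gives linear
independence. -/
theorem wordAction_wordVal {l : List (PolygonLetter n)} (h : IsNormal l) :
    wordAction k (wordVal k l) (.single [] 1) = .single l 1 := by
  induction l with
  | nil => simp [wordVal]
  | cons x l ih =>
    have : wordVal k (x :: l) = x.val k * wordVal k l := by simp [wordVal]
    rw [this, map_mul, Module.End.mul_apply, ih h.tail, wordAction_val, mulOp_single,
      mulWord_eq_single k h]

theorem wordMap_faceVal (a : PolygonFace n) (m : List (PolygonLetter n) →₀ k) :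
    wordMap k (faceVal (mulOp k) a m) = faceVal (val k) a * wordMap k m := by
  rcases a with _ | i | i | _ <;> simp [faceVal, wordMap_mulOp]

/-- `wordMap` turns the action into left multiplication and sends the empty word to `1`. With
`wordAction_prod_gen_mem` it writes every product of edges in normal words. -/
theorem wordMap_wordAction_prod_gen (l : List (PolygonEdge n)) :
    wordMap k (wordAction k (l.map ((polygonGraph n).gen k)).prod (.single [] 1)) =
      (l.map ((polygonGraph n).gen k)).prod := by
  induction l with
  | nil => simp [wordVal]
  | cons e l ih =>
    rw [List.map_cons, List.prod_cons, map_mul, Module.End.mul_apply, wordAction_gen, edgeVal,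
      LinearMap.sub_apply, map_sub, wordMap_faceVal, wordMap_faceVal, ih, ← sub_mul, ← edgeVal,
      ← gen_eq_edgeVal]

theorem faceVal_mulOp_mem_normalSpan (a : PolygonFace n) {d : ℕ}
    {m : List (PolygonLetter n) →₀ k} (h : m ∈ normalSpan k n d) :
    faceVal (mulOp k) a m ∈ normalSpan k n (1 + d) := by
  rcases a with _ | i | i | _
  · exact zero_mem _
  all_goals exact mulOp_mem_normalSpan k _ h

theorem wordAction_prod_gen_mem (l : List (PolygonEdge n)) :
    wordAction k (l.map ((polygonGraph n).gen k)).prod (.single [] 1) ∈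
      normalSpan k n l.length := by
  induction l with
  | nil =>
    rw [List.map_nil, List.prod_nil, map_one]
    exact Finsupp.single_mem_supported _ _ ⟨List.isChain_nil, rfl⟩
  | cons e l ih =>
    rw [List.map_cons, List.prod_cons, map_mul, Module.End.mul_apply, wordAction_gen, edgeVal,
      LinearMap.sub_apply, List.length_cons, add_comm]
    exact sub_mem (faceVal_mulOp_mem_normalSpan k _ ih) (faceVal_mulOp_mem_normalSpan k _ ih)

/-- The normal words of degree `d`. -/
abbrev NormalWord (n d : ℕ) : Type :=
  {l : List (PolygonLetter n) // IsNormal l ∧ wordDeg l = d}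

/-- The element of `A(Γ_{D_n})_[d]` given by a normal word of degree `d`. -/
noncomputable def normalWordVal {d : ℕ} (l : NormalWord n d) : (polygonGraph n).component k d :=
  ⟨wordVal k l.1, by simpa only [l.2.2] using wordVal_mem_component k l.1⟩

theorem linearIndependent_normalWordVal (d : ℕ) :
    LinearIndependent k (normalWordVal (n := n) (d := d) k) := by
  let f : (polygonGraph n).component k d →ₗ[k] List (PolygonLetter n) →₀ k :=
    (LinearMap.applyₗ (.single [] 1)).comp
      ((wordAction k).toLinearMap.comp ((polygonGraph n).component k d).subtype)
  have hf : f ∘ normalWordVal k = (fun l => .single l 1) ∘ (Subtype.val : NormalWord n d → _) :=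
    funext fun l => wordAction_wordVal k l.2.1
  refine LinearIndependent.of_comp f ?_
  rw [hf]
  exact (Finsupp.linearIndependent_single_one k _).comp _ Subtype.val_injective

theorem span_normalWordVal (d : ℕ) :
    ⊤ ≤ Submodule.span k (Set.range (normalWordVal (n := n) (d := d) k)) := by
  have key : (polygonGraph n).component k d ≤
      (Submodule.span k (Set.range (normalWordVal (n := n) (d := d) k))).map
        ((polygonGraph n).component k d).subtype := by
    refine Submodule.span_le.2 ?_
    rintro _ ⟨l, rfl, rfl⟩
    have h := wordAction_prod_gen_mem k l
    rw [SetLike.mem_coe, ← wordMap_wordAction_prod_gen, Submodule.map_span]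
    rw [normalSpan, Finsupp.supported_eq_span_single] at h
    have := Submodule.mem_map_of_mem (f := wordMap k) h
    rw [Submodule.map_span] at this
    refine Submodule.span_mono ?_ this
    rintro _ ⟨_, ⟨l, hl, rfl⟩, rfl⟩
    exact ⟨_, ⟨⟨l, hl⟩, rfl⟩, (wordMap_single k l).symm⟩
  rintro x -
  obtain ⟨y, hy, hyx⟩ := key x.2
  rwa [← Subtype.ext hyx]

/-- The basis of `A(Γ_{D_n})_[d]` consisting of the normal words of degree `d`. -/
noncomputable def normalBasis (n d : ℕ) :
    Module.Basis (NormalWord n d) k ((polygonGraph n).component k d) :=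
  .mk (linearIndependent_normalWordVal k d) (span_normalWordVal k d)

end

/-! ### The action on normal words -/

theorem reducible_smul (g : DihedralGroup n) (x y : PolygonLetter n) :
    Reducible (g • x) (g • y) ↔ Reducible x y := by
  have h1 : ∀ a i j : ZMod n, j + a = i + a + 1 ↔ j = i + 1 := fun a i j =>
    ⟨fun h => by linear_combination h, fun h => by linear_combination h⟩
  have h2 : ∀ a i j : ZMod n, 3 - (j + a) = 2 - (i + a) ↔ j = i + 1 := fun a i j =>
    ⟨fun h => by linear_combination -h, fun h => by linear_combination -h⟩
  have h3 : ∀ a i j : ZMod n, 3 - (j + a) = 2 - (i + a) + 1 ↔ j = i := fun a i j =>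
    ⟨fun h => by linear_combination -h, fun h => by linear_combination -h⟩
  rcases g with a | a <;> rcases x with _ | _ | _ | i | i | i <;>
    rcases y with _ | _ | _ | j | j | j
  all_goals first
    | exact Iff.rfl
    | exact or_congr (add_left_inj a) (h1 a i j)
    -- A reflection interchanges the two ends of a side.
    | exact (or_congr (h2 a i j) (h3 a i j)).trans or_comm

theorem IsNormal.map_smul {l : List (PolygonLetter n)} (h : IsNormal l) (g : DihedralGroup n) :
    IsNormal (l.map (g • ·)) := by
  rw [IsNormal, List.isChain_map]
  simp only [reducible_smul]
  exact h

theorem wordDeg_map_smul (g : DihedralGroup n) (l : List (PolygonLetter n)) :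
    wordDeg (l.map (g • ·)) = wordDeg l := by
  simp [wordDeg, Function.comp_def, deg_smul]

theorem map_smul_eq_self_iff {g : DihedralGroup n} {l : List (PolygonLetter n)} :
    l.map (g • ·) = l ↔ ∀ x ∈ l, g • x = x := by
  simpa using List.map_inj_left (l := l) (f := (g • ·)) (g := id)

/-- The image of a normal word under an element of the dihedral group. -/
def smulWord {d : ℕ} (g : DihedralGroup n) (l : NormalWord n d) : NormalWord n d :=
  ⟨l.1.map (g • ·), l.2.1.map_smul g, by rw [wordDeg_map_smul, l.2.2]⟩

theorem polygonRep_normalBasis (k : Type*) [Field k] {d : ℕ} (g : DihedralGroup n)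
    (l : NormalWord n d) :
    polygonRep k n d g (normalBasis k n d l) = normalBasis k n d (smulWord g l) := by
  simp only [normalBasis, Module.Basis.mk_apply]
  exact Subtype.ext (autHom_wordVal k g l.1)

instance [NeZero n] : Finite (PolygonLetter n) := by
  refine Finite.of_surjective
    (Sum.elim (fun i : Fin 3 => ![u1, u2, u3] i)
      (Sum.elim v1 (Sum.elim v2 w)) : Fin 3 ⊕ ZMod n ⊕ ZMod n ⊕ ZMod n → PolygonLetter n) ?_
  rintro (_ | _ | _ | i | i | i)
  exacts [⟨.inl 0, rfl⟩, ⟨.inl 1, rfl⟩, ⟨.inl 2, rfl⟩, ⟨.inr (.inl i), rfl⟩,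
    ⟨.inr (.inr (.inl i)), rfl⟩, ⟨.inr (.inr (.inr i)), rfl⟩]

theorem deg_pos (x : PolygonLetter n) : 0 < x.deg := by
  rcases x with _ | _ | _ | i | i | i <;> simp [deg]

end PolygonLetter

/-! ### Counting words without forbidden subwords of length two -/

namespace WordCount

variable {α : Type*} [Finite α] {deg : α → ℕ} (hdeg : ∀ x, 0 < deg x)
  (R : α → α → Prop) (F : Finset α)

/-- Letters have positive degree, so the length is at most the degree. -/
theorem finite_words {deg : α → ℕ} (hdeg : ∀ x, 0 < deg x) (R : α → α → Prop) (F : Finset α)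
    (d : ℕ) : {l : List α | (∀ x ∈ l, x ∈ F) ∧ l.IsChain (fun x y => ¬ R x y) ∧
    (l.map deg).sum = d}.Finite := by
  refine (List.finite_length_le α d).subset ?_
  rintro l ⟨-, -, rfl⟩
  have := List.card_nsmul_le_sum (l.map deg) 1 fun a ha => by
    obtain ⟨x, -, rfl⟩ := List.mem_map.1 ha
    exact hdeg x
  simpa using this

/-- The words of degree `d` in the letters `F` without subwords `[x, y]` with `R x y`. -/
noncomputable def words (d : ℕ) : Finset (List α) :=
  (finite_words hdeg R F d).toFinset

theorem mem_words {d : ℕ} {l : List α} : l ∈ words hdeg R F d ↔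
    (∀ x ∈ l, x ∈ F) ∧ l.IsChain (fun x y => ¬ R x y) ∧ (l.map deg).sum = d := by
  simp [words]

open Classical in
/-- The words in `words hdeg R F d` with first letter `x`. -/
noncomputable def wordsFrom (x : α) (d : ℕ) : Finset (List α) :=
  (words hdeg R F d).filter fun l => l.head? = some x

/-- The generating function of `words`. -/
noncomputable def series : ℚ⟦X⟧ :=
  PowerSeries.mk fun d => ((words hdeg R F d).card : ℚ)

/-- The generating function of `wordsFrom`. -/
noncomputable def seriesFrom (x : α) : ℚ⟦X⟧ :=
  PowerSeries.mk fun d => ((wordsFrom hdeg R F x d).card : ℚ)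

open Classical in
theorem card_filter_head (T : Finset α) (d : ℕ) :
    ((words hdeg R F d).filter fun l => ∃ y ∈ T, l.head? = some y).card =
      ∑ y ∈ T, (wordsFrom hdeg R F y d).card := by
  rw [← Finset.card_biUnion]
  · congr 1
    ext l
    simp only [wordsFrom, Finset.mem_filter, Finset.mem_biUnion]
    tauto
  · intro x _ y _ hxy
    rw [Function.onFun, Finset.disjoint_left]
    intro l h1 h2
    simp only [wordsFrom, Finset.mem_filter] at h1 h2
    exact hxy (Option.some_injective _ (h1.2.symm.trans h2.2))

/-- Words are sorted by their first letter; the `1` is the empty word. -/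
theorem series_eq : series hdeg R F = 1 + ∑ x ∈ F, seriesFrom hdeg R F x := by
  classical
  ext d
  rw [map_add, map_sum]
  simp only [series, seriesFrom, PowerSeries.coeff_mk, PowerSeries.coeff_one]
  rw [← Nat.cast_sum, ← card_filter_head]
  rcases Nat.eq_zero_or_pos d with rfl | hd
  · have h : words hdeg R F 0 = {[]} := by
      ext l
      rw [mem_words, Finset.mem_singleton]
      refine ⟨fun h => ?_, fun h => by simp [h]⟩
      rcases l with _ | ⟨x, l⟩
      · rfl
      · have := h.2.2; have := hdeg x; simp at *; omega
    simp [h, Finset.filter_singleton]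
  · rw [if_neg hd.ne', zero_add, Finset.filter_true_of_mem]
    intro l hl
    rw [mem_words] at hl
    rcases l with _ | ⟨x, l⟩
    · have := hl.2.2; simp at this; omega
    · exact ⟨x, hl.1 x (by simp), rfl⟩

-- Deleting the first letter `x` leaves any word that does not begin with a `y` such that `R x y`.
open Classical in
theorem seriesFrom_eq {x : α} (hx : x ∈ F) : seriesFrom hdeg R F x =
    PowerSeries.X ^ deg x *
      (series hdeg R F - ∑ y ∈ F.filter (R x), seriesFrom hdeg R F y) := by
  ext d
  rw [PowerSeries.coeff_X_pow_mul']
  split_ifs with hd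
  · obtain ⟨d, rfl⟩ := Nat.exists_eq_add_of_le hd
    rw [Nat.add_sub_cancel_left, map_sub, map_sum]
    simp only [series, seriesFrom, PowerSeries.coeff_mk]
    rw [← Nat.cast_sum, ← card_filter_head, eq_sub_iff_add_eq, ← Nat.cast_add, Nat.cast_inj,
      ← Finset.card_filter_add_card_filter_not (s := words hdeg R F d)
        (fun l => ∃ y ∈ F.filter (R x), l.head? = some y), add_comm, Nat.add_left_cancel_iff]
    symm
    refine Finset.card_bij (fun l _ => x :: l) ?_ (fun _ _ _ _ h => (List.cons.inj h).2) ?_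
    · intro l hl
      simp only [wordsFrom, Finset.mem_filter, mem_words] at hl ⊢
      obtain ⟨⟨h1, h2, h3⟩, h4⟩ := hl
      refine ⟨⟨by simpa [hx] using h1, ?_, by simp [h3]⟩, rfl⟩
      rcases l with _ | ⟨y, l⟩
      · exact List.isChain_singleton _
      · exact List.isChain_cons_cons.2 ⟨fun h => h4 ⟨y, ⟨h1 y (by simp), h⟩, rfl⟩, h2⟩
    · intro l hl
      simp only [wordsFrom, Finset.mem_filter, mem_words] at hl
      obtain ⟨⟨h1, h2, h3⟩, h4⟩ := hl
      rcases l with _ | ⟨x', l⟩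
      · simp at h4
      obtain rfl : x' = x := by simpa using h4
      refine ⟨l, ?_, rfl⟩
      simp only [Finset.mem_filter, mem_words]
      refine ⟨⟨fun y hy => h1 y (by simp [hy]), h2.tail, by simpa using h3⟩, ?_⟩
      rintro ⟨y, ⟨-, hy⟩, hy'⟩
      rcases l with _ | ⟨z, l⟩
      · simp at hy'
      obtain rfl : z = y := by simpa using hy'
      exact (List.isChain_cons_cons.1 h2).1 hy
  · rw [seriesFrom, PowerSeries.coeff_mk, Nat.cast_eq_zero, Finset.card_eq_zero,
      Finset.eq_empty_iff_forall_notMem]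
    intro l hl
    simp only [wordsFrom, Finset.mem_filter, mem_words] at hl
    obtain ⟨⟨-, -, h3⟩, h4⟩ := hl
    rcases l with _ | ⟨x', l⟩
    · simp at h4
    obtain rfl : x' = x := by simpa using h4
    simp at h3
    omega

end WordCount

/-! ### The graded traces -/

namespace PolygonLetter

variable {n : ℕ} [NeZero n]

noncomputable instance : Fintype (PolygonLetter n) := Fintype.ofFinite _

/-- The set of letters, as a disjoint union. -/
def sumEquiv (n : ℕ) : Fin 3 ⊕ ZMod n ⊕ ZMod n ⊕ ZMod n ≃ PolygonLetter n where
  toFun := Sum.elim ![u1, u2, u3] (Sum.elim v1 (Sum.elim v2 w))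
  invFun
    | u1 => .inl 0
    | u2 => .inl 1
    | u3 => .inl 2
    | v1 i => .inr (.inl i)
    | v2 i => .inr (.inr (.inl i))
    | w i => .inr (.inr (.inr i))
  left_inv := by
    rintro (i | i | i | i)
    · fin_cases i <;> rfl
    all_goals rfl
  right_inv := by rintro (_ | _ | _ | i | i | i) <;> rfl

theorem sum_eq {M : Type*} [AddCommMonoid M] (f : PolygonLetter n → M) :
    ∑ x, f x = f u1 + f u2 + f u3 + (∑ i, f (v1 i) + (∑ i, f (v2 i) + ∑ i, f (w i))) := by
  rw [← (sumEquiv n).sum_comp]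
  simp [sumEquiv, Fin.sum_univ_three]

open PowerSeries WordCount in
/-- The generating function of the normal words in a set of letters. -/
theorem series_mul_eq_one (F : Finset (PolygonLetter n)) (P Q : Finset (ZMod n)) (p q m : ℕ)
    (hu1 : u1 ∈ F) (hu2 : u2 ∈ F) (hu3 : u3 ∈ F) (hv1 : ∀ i, v1 i ∈ F ↔ i ∈ P)
    (hv2 : ∀ i, v2 i ∈ F ↔ i ∈ P) (hw : ∀ i, w i ∈ F ↔ i ∈ Q)
    (hp : P.card = p) (hq : Q.card = q)
    (hm : ∑ i ∈ P, (Q.filter fun j => j = i ∨ j = i + 1).card = m) :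
    series deg_pos Reducible F * (1 - (1 + p + q : ℚ⟦X⟧) * X + (m - 1 : ℚ⟦X⟧) * X ^ 2 +
      (p + q - 1 - m : ℚ⟦X⟧) * X ^ 3) = 1 := by
  classical
  set S := series deg_pos Reducible F with hS
  set N := seriesFrom deg_pos Reducible F with hN
  have hF : ∀ (T : PolygonLetter n → Prop), ∑ x ∈ F.filter T, N x =
      (if T u1 then N u1 else 0) + (if T u2 then N u2 else 0) + (if T u3 then N u3 else 0) +
      (∑ i ∈ P, (if T (v1 i) then N (v1 i) else 0) +
      (∑ i ∈ P, (if T (v2 i) then N (v2 i) else 0) +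
        ∑ i ∈ Q, (if T (w i) then N (w i) else 0))) := fun T => by
    have hF' : F = Finset.univ.filter (· ∈ F) := by simp
    rw [Finset.sum_filter]
    conv_lhs => rw [hF', Finset.sum_filter]
    rw [sum_eq]
    simp [hu1, hu2, hu3, hv1, hv2, hw]
  -- The recursion is triangular: `w`, `v2` and `u3` start no reducible pair, `v1` and `u2` refer
  -- only to `w`, and `u1` only to `v1` and `v2`. The number `m` counts incident pairs of a side in
  -- `P` and a vertex in `Q`.
  have hNw : ∀ j ∈ Q, N (w j) = X * S := fun j hj => by
    rw [hN, seriesFrom_eq _ _ _ ((hw j).2 hj), ← hN, hF]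
    simp [Reducible, deg, hS]
  have hNv2 : ∀ i ∈ P, N (v2 i) = X ^ 2 * S := fun i hi => by
    rw [hN, seriesFrom_eq _ _ _ ((hv2 i).2 hi), ← hN, hF]
    simp [Reducible, deg, hS]
  have hNu3 : N u3 = X ^ 3 * S := by
    rw [hN, seriesFrom_eq _ _ _ hu3, ← hN, hF]
    simp [Reducible, deg, hS]
  have hNv1 : ∀ i ∈ P, N (v1 i) =
      X * (S - ((Q.filter fun j => j = i ∨ j = i + 1).card : ℚ⟦X⟧) * (X * S)) := fun i hi => by
    have e : ∑ x ∈ F.filter (Reducible (v1 i)), N x =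
        ∑ j ∈ Q, if j = i ∨ j = i + 1 then N (w j) else 0 := by
      rw [hF]; simp [Reducible]
      refine Finset.sum_congr rfl fun j _ => ?_
      by_cases h : j = i ∨ j = i + 1
      · exact (if_pos h).trans (if_pos h).symm
      · exact (if_neg h).trans (if_neg h).symm
    rw [hN, seriesFrom_eq _ _ _ ((hv1 i).2 hi), ← hN, e, ← Finset.sum_filter,
      Finset.sum_congr rfl fun j hj => hNw j (Finset.mem_filter.1 hj).1,
      Finset.sum_const, nsmul_eq_mul, deg, pow_one]
  have hNu2 : N u2 = X ^ 2 * (S - (q : ℚ⟦X⟧) * (X * S)) := by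
    have e : ∑ x ∈ F.filter (Reducible u2), N x = ∑ j ∈ Q, N (w j) := by
      rw [hF]; simp [Reducible]
    rw [hN, seriesFrom_eq _ _ _ hu2, ← hN, e, Finset.sum_congr rfl hNw, Finset.sum_const,
      nsmul_eq_mul, hq, deg]
  have hsv1 : ∑ i ∈ P, N (v1 i) = (p : ℚ⟦X⟧) * (X * S) - (m : ℚ⟦X⟧) * (X ^ 2 * S) := by
    rw [Finset.sum_congr rfl hNv1, ← Finset.mul_sum, Finset.sum_sub_distrib, ← Finset.sum_mul,
      ← Nat.cast_sum, hm, Finset.sum_const, nsmul_eq_mul, hp]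
    ring
  have hsv2 : ∑ i ∈ P, N (v2 i) = (p : ℚ⟦X⟧) * (X ^ 2 * S) := by
    rw [Finset.sum_congr rfl hNv2, Finset.sum_const, nsmul_eq_mul, hp]
  have hsw : ∑ i ∈ Q, N (w i) = (q : ℚ⟦X⟧) * (X * S) := by
    rw [Finset.sum_congr rfl hNw, Finset.sum_const, nsmul_eq_mul, hq]
  have hNu1 : N u1 = X * (S - ((p : ℚ⟦X⟧) * (X * S) - (m : ℚ⟦X⟧) * (X ^ 2 * S) + (p : ℚ⟦X⟧) * (X ^ 2 * S))) := by
    have e : ∑ x ∈ F.filter (Reducible u1), N x =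
        ∑ i ∈ P, N (v1 i) + ∑ i ∈ P, N (v2 i) := by rw [hF]; simp [Reducible]
    rw [hN, seriesFrom_eq _ _ _ hu1, ← hN, e, hsv1, hsv2, deg, pow_one]
  have key : S = 1 + _ := series_eq deg_pos Reducible F
  have h1 := hF fun _ => True
  simp only [if_true, Finset.filter_true] at h1
  rw [← hN, h1, hNu1, hNu2, hNu3, hsv1, hsv2, hsw] at key
  linear_combination key

open Classical in
/-- The letters fixed by an element of the dihedral group. -/
noncomputable def fixedLetters (g : DihedralGroup n) : Finset (PolygonLetter n) :=
  Finset.univ.filter fun x => g • x = x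

instance (d : ℕ) : Finite (NormalWord n d) :=
  ((WordCount.finite_words deg_pos Reducible Finset.univ d).subset
    fun l (h : IsNormal l ∧ wordDeg l = d) => ⟨by simp, h.1, h.2⟩).to_subtype

-- In the basis of normal words `g` is a permutation matrix, and a word is fixed exactly when each
-- of its letters is.
open Classical in
theorem trace_polygonRep (k : Type*) [Field k] (d : ℕ) (g : DihedralGroup n) :
    LinearMap.trace k _ (polygonRep k n d g) =
      (WordCount.words deg_pos Reducible (fixedLetters g) d).card := by
  have := Fintype.ofFinite (NormalWord n d)
  rw [LinearMap.trace_eq_matrix_trace k (normalBasis k n d), Matrix.trace]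
  simp only [Matrix.diag_apply, LinearMap.toMatrix_apply, polygonRep_normalBasis,
    Module.Basis.repr_self, Finsupp.single_apply]
  rw [Finset.sum_boole]
  congr 1
  refine Finset.card_bij (fun l _ => l.1) ?_ (fun _ _ _ _ h => Subtype.ext h) ?_
  · intro l hl
    rw [Finset.mem_filter, Subtype.ext_iff] at hl
    rw [WordCount.mem_words]
    refine ⟨fun x hx => ?_, l.2⟩
    simpa [fixedLetters] using (map_smul_eq_self_iff.1 hl.2) x hx
  · intro l hl
    rw [WordCount.mem_words] at hl
    refine ⟨⟨l, hl.2⟩, ?_, rfl⟩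
    rw [Finset.mem_filter, Subtype.ext_iff]
    exact ⟨Finset.mem_univ _, map_smul_eq_self_iff.2 fun x hx => by
      simpa [fixedLetters] using hl.1 x hx⟩

theorem hasGradedTrace_of_mul_eq_one (k : Type*) [Field k] [CharZero k] (g : DihedralGroup n)
    {f h : ℚ⟦X⟧} (hf : f = h⁻¹) (h0 : PowerSeries.constantCoeff h ≠ 0)
    (hs : WordCount.series deg_pos Reducible (fixedLetters g) * h = 1) :
    HasGradedTrace k n g f := by
  intro d
  rw [trace_polygonRep, hf, ← (PowerSeries.eq_inv_iff_mul_eq_one h0).2 hs]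
  simp [WordCount.series]

theorem hasGradedTrace_one (hn : 2 ≤ n) (k : Type*) [Field k] [CharZero k] :
    HasGradedTrace k n 1 (seriesA n) := by
  have : Fact (1 < n) := ⟨hn⟩
  refine hasGradedTrace_of_mul_eq_one k 1 rfl (by simp) ?_
  have := series_mul_eq_one (n := n) (fixedLetters 1) Finset.univ Finset.univ n n (2 * n)
    (by simp [fixedLetters]) (by simp [fixedLetters]) (by simp [fixedLetters])
    (by simp [fixedLetters]) (by simp [fixedLetters]) (by simp [fixedLetters])
    (by simp [ZMod.card]) (by simp [ZMod.card]) ?_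
  · refine Eq.trans ?_ this
    simp only [map_add, map_sub, map_mul, map_natCast, map_ofNat, map_one]
    push_cast
    ring
  -- Each side has two distinct ends, because `1 ≠ 0` in `ZMod n`.
  · have h : ∀ i : ZMod n, (Finset.univ.filter fun j => j = i ∨ j = i + 1).card = 2 := fun i => by
      rw [← Finset.card_pair (a := i) (b := i + 1) (by simp)]
      congr 1
      ext j
      simp
    simp [h, ZMod.card, mul_comm]

theorem hasGradedTrace_r (k : Type*) [Field k] [CharZero k] {i : ZMod n} (hi : i ≠ 0) :
    HasGradedTrace k n (.r i) seriesB := by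
  refine hasGradedTrace_of_mul_eq_one k _ rfl (by simp) ?_
  have hv1 : ∀ j : ZMod n, (DihedralGroup.r i • v1 j : PolygonLetter n) = v1 (j + i) :=
    fun _ => rfl
  have hv2 : ∀ j : ZMod n, (DihedralGroup.r i • v2 j : PolygonLetter n) = v2 (j + i) :=
    fun _ => rfl
  have hw : ∀ j : ZMod n, (DihedralGroup.r i • w j : PolygonLetter n) = w (j + i) :=
    fun _ => rfl
  have := series_mul_eq_one (n := n) (fixedLetters (.r i)) ∅ ∅ 0 0 0
    (by simp [fixedLetters]; rfl) (by simp [fixedLetters]; rfl) (by simp [fixedLetters]; rfl)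
    (by simp [fixedLetters, hv1, hi]) (by simp [fixedLetters, hv2, hi])
    (by simp [fixedLetters, hw, hi]) rfl rfl (by simp)
  refine Eq.trans ?_ this
  push_cast
  ring

/-- The two terms will count the sides and the vertices on the axis of a reflection: one of each for
`n` odd, two of one kind for `n` even. -/
theorem _root_.ZMod.card_two_mul_eq_add_card_two_mul_eq (c : ZMod n) :
    (Finset.univ.filter fun i : ZMod n => 2 * i = c).card +
      (Finset.univ.filter fun i : ZMod n => 2 * i = c + 1).card = 2 := by
  rcases Nat.even_or_odd n with hn | hn
  · have hdvd : 2 ∣ n := hn.two_dvd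
    obtain ⟨m, hm⟩ := hn
    have hn0 : 0 < n := NeZero.pos n
    -- The solutions are `e` and `e + n/2`.
    have hE : ∀ e : ZMod n, (Finset.univ.filter fun i : ZMod n => 2 * i = 2 * e).card = 2 := by
      intro e
      have hm0 : (m : ZMod n) ≠ 0 := by
        rw [Ne, ZMod.natCast_eq_zero_iff]
        exact Nat.not_dvd_of_pos_of_lt (by omega) (by omega)
      have hmm : (m : ZMod n) + m = 0 := by rw [← Nat.cast_add, ← hm, ZMod.natCast_self]
      rw [← Finset.card_pair (a := e) (b := e + m) (by simpa using hm0)]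
      congr 1
      ext i
      simp only [Finset.mem_filter, Finset.mem_univ, true_and, Finset.mem_insert,
        Finset.mem_singleton]
      refine ⟨fun h => ?_, ?_⟩
      · have h2 : ((2 * (i - e).val : ℕ) : ZMod n) = 0 := by
          push_cast
          rw [ZMod.natCast_zmod_val]
          linear_combination h
        rw [ZMod.natCast_eq_zero_iff] at h2
        obtain ⟨t, ht⟩ := h2
        have hlt := ZMod.val_lt (i - e)
        have ht2 : t < 2 := by
          by_contra! h2
          have := Nat.mul_le_mul_left n h2
          omega
        have hi : i = e + ((i - e).val : ZMod n) := by rw [ZMod.natCast_zmod_val]; ring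
        interval_cases t
        · left
          rw [hi, show (i - e).val = 0 by omega]
          simp
        · right
          rw [hi, show (i - e).val = m by omega]
      · rintro (rfl | rfl)
        · rfl
        · linear_combination hmm
    -- Reduction modulo `2` rules out a solution.
    have hO : ∀ e : ZMod n, (Finset.univ.filter fun i : ZMod n => 2 * i = 2 * e + 1).card = 0 := by
      intro e
      rw [Finset.card_eq_zero, Finset.filter_eq_empty_iff]
      intro i _ h
      have := congrArg (ZMod.castHom hdvd (ZMod 2)) h
      rw [map_mul, map_add, map_mul, map_ofNat, map_one, show (OfNat.ofNat 2 : ZMod 2) = 0 from rfl]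
        at this
      simp at this
    rcases Nat.even_or_odd' c.val with ⟨e, he | he⟩
    · have hc : c = 2 * (e : ZMod n) := by
        rw [← ZMod.natCast_zmod_val c, he]; push_cast; rfl
      rw [hc, hE, hO]
    · have hc : c = 2 * (e : ZMod n) + 1 := by
        rw [← ZMod.natCast_zmod_val c, he]; push_cast; rfl
      rw [hc, show 2 * (e : ZMod n) + 1 + 1 = 2 * (e + 1) by ring, hE, hO]
  · have hu : IsUnit (2 : ZMod n) := by
      have := (ZMod.isUnit_iff_coprime 2 n).2 (Nat.coprime_two_left.2 hn)
      simpa using this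
    have h : ∀ c : ZMod n, (Finset.univ.filter fun i : ZMod n => 2 * i = c).card = 1 := fun c => by
      rw [Finset.card_eq_one]
      obtain ⟨u, hu⟩ := hu
      refine ⟨↑u⁻¹ * c, ?_⟩
      ext i
      simp only [Finset.mem_filter, Finset.mem_univ, true_and, Finset.mem_singleton, ← hu]
      rw [Units.eq_inv_mul_iff_mul_eq]
    rw [h, h]

/-- A fixed side has its ends interchanged, so `m = 0`; then only `p + q = 2` enters the
denominator, whatever the parity of `n`. -/
theorem hasGradedTrace_sr (hn : 2 ≤ n) (k : Type*) [Field k] [CharZero k] (a : ZMod n) :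
    HasGradedTrace k n (.sr a) seriesC := by
  have : Fact (1 < n) := ⟨hn⟩
  have h10 : (1 : ZMod n) ≠ 0 := one_ne_zero
  refine hasGradedTrace_of_mul_eq_one k _ rfl (by simp) ?_
  have hv1 : ∀ j : ZMod n, (DihedralGroup.sr a • v1 j : PolygonLetter n) = v1 (2 - (j + a)) :=
    fun _ => rfl
  have hv2 : ∀ j : ZMod n, (DihedralGroup.sr a • v2 j : PolygonLetter n) = v2 (2 - (j + a)) :=
    fun _ => rfl
  have hw : ∀ j : ZMod n, (DihedralGroup.sr a • w j : PolygonLetter n) = w (3 - (j + a)) :=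
    fun _ => rfl
  have hP : ∀ j : ZMod n, 2 - (j + a) = j ↔ 2 * j = 2 - a := fun j =>
    ⟨fun h => by linear_combination -h, fun h => by linear_combination -h⟩
  have hQ : ∀ j : ZMod n, 3 - (j + a) = j ↔ 2 * j = 2 - a + 1 := fun j =>
    ⟨fun h => by linear_combination -h, fun h => by linear_combination -h⟩
  have := series_mul_eq_one (n := n) (fixedLetters (.sr a))
    (Finset.univ.filter fun i : ZMod n => 2 * i = 2 - a)
    (Finset.univ.filter fun i : ZMod n => 2 * i = 2 - a + 1) _ _ 0
    (by simp [fixedLetters]; rfl) (by simp [fixedLetters]; rfl) (by simp [fixedLetters]; rfl)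
    (by simp [fixedLetters, hv1, hP]) (by simp [fixedLetters, hv2, hP])
    (by simp [fixedLetters, hw, hQ]) rfl rfl ?_
  · refine Eq.trans ?_ this
    have h2 := congrArg (Nat.cast (R := ℚ⟦X⟧)) (ZMod.card_two_mul_eq_add_card_two_mul_eq (2 - a))
    push_cast at h2 ⊢
    linear_combination (PowerSeries.X * WordCount.series deg_pos Reducible (fixedLetters (.sr a)) -
      PowerSeries.X ^ 3 * WordCount.series deg_pos Reducible (fixedLetters (.sr a))) * h2
  · refine Finset.sum_eq_zero fun i hi => ?_
    rw [Finset.card_eq_zero, Finset.filter_eq_empty_iff]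
    simp only [Finset.mem_filter, Finset.mem_univ, true_and] at hi ⊢
    rintro j hj (rfl | rfl)
    · exact h10 (by linear_combination hj.symm.trans hi)
    · exact h10 (by linear_combination hj - hi)

end PolygonLetter

/-! ### Multiplicities and characters -/

namespace Representation

variable {k G V W : Type*} [Field k] [Group G] [AddCommGroup V] [Module k V] [AddCommGroup W]
  [Module k W]

theorem IsIrreducible.finiteDimensional [Finite G] {ρ : Representation k G V}
    (h : ρ.IsIrreducible) : FiniteDimensional k V := by
  have : IsSimpleModule k[G] ρ.asModule := (irreducible_iff_isSimpleModule_asModule ρ).1 h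
  have : Module.Finite k k[G] := inferInstance
  have : Module.Finite k ρ.asModule := Module.Finite.trans k[G] _
  exact this

/-- The multiplicity of an absolutely irreducible representation is the dimension of the space of
intertwining maps. -/
theorem multiplicity_eq_finrank [Finite G] [FiniteDimensional k W] {ρ : Representation k G V}
    (hρ : ρ.IsIrreducible) (h1 : Module.finrank k (IntertwiningMap ρ ρ) = 1)
    (σ : Representation k G W) :
    ρ.multiplicity σ = Module.finrank k (IntertwiningMap ρ σ) := by
  have : IsSimpleModule k[G] ρ.asModule := (irreducible_iff_isSimpleModule_asModule ρ).1 hρ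
  have : FiniteDimensional k σ.asModule := inferInstance
  have : IsNoetherian k[G] σ.asModule := isNoetherian_of_tower k inferInstance
  set I := isotypicComponent k[G] σ.asModule ρ.asModule with hI
  obtain ⟨m, ⟨e⟩⟩ :=
    (IsIsotypicOfType.isotypicComponent k[G] σ.asModule (S := ρ.asModule)).linearEquiv_fun
  have hlen : ρ.multiplicity σ = m := by
    rw [multiplicity, e.length_eq, Module.length_pi_of_fintype]
    simp [Module.length_eq_one]
  -- With `I ≅ ρ^m`, this realises `(End ρ)^m ≅ Hom(ρ, I) ≅ Hom(ρ, σ)`.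
  let T : (Fin m → (ρ.asModule →ₗ[k[G]] ρ.asModule)) →ₗ[k] (ρ.asModule →ₗ[k[G]] σ.asModule) :=
    { toFun := fun c => I.subtype ∘ₗ e.symm.toLinearMap ∘ₗ LinearMap.pi c
      map_add' := fun c c' => by
        ext x
        have : LinearMap.pi (c + c') x = LinearMap.pi c x + LinearMap.pi c' x := rfl
        simp [this]
      map_smul' := fun a c => by
        ext x
        have : LinearMap.pi (a • c) x = a • LinearMap.pi c x := rfl
        have h : e.symm (a • LinearMap.pi c x) = a • e.symm (LinearMap.pi c x) :=
          LinearMap.map_smul_of_tower e.symm.toLinearMap a _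
        simp [this, h] }
  have hT : Function.Bijective T := by
    constructor
    · rw [← LinearMap.ker_eq_bot, LinearMap.ker_eq_bot']
      intro c hc
      funext i
      ext x
      have h : I.subtype (e.symm (LinearMap.pi c x)) = 0 := LinearMap.congr_fun hc x
      have h' : LinearMap.pi c x = 0 :=
        e.symm.map_eq_zero_iff.1 (Subtype.ext h)
      exact congrFun h' i
    · intro f
      -- A homomorphism maps isotypic components into isotypic components, and `ρ` is its own.
      have hf : ∀ x, f x ∈ I := by
        have := LinearMap.le_comap_isotypicComponent ρ.asModule f
        intro x
        refine this ?_
        rw [isotypicComponent_eq_top_iff.2 (.of_isSimpleModule _ _)]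
        trivial
      refine ⟨fun i => LinearMap.proj i ∘ₗ e.toLinearMap ∘ₗ f.codRestrict I hf, ?_⟩
      ext x
      have : LinearMap.pi (fun i => LinearMap.proj i ∘ₗ e.toLinearMap ∘ₗ f.codRestrict I hf) x =
          e (f.codRestrict I hf x) := rfl
      change I.subtype (e.symm (LinearMap.pi _ x)) = f x
      rw [this, e.symm_apply_apply]
      rfl
  have hfin : Module.finrank k (ρ.asModule →ₗ[k[G]] ρ.asModule) = 1 := by
    rw [← h1, (IntertwiningMap.equivLinearMapAsModule ρ ρ).finrank_eq]
  have : Module.Finite k (ρ.asModule →ₗ[k[G]] ρ.asModule) :=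
    Module.finite_of_finrank_pos (by omega)
  rw [hlen, (IntertwiningMap.equivLinearMapAsModule ρ σ).finrank_eq,
    ← (LinearEquiv.ofBijective T hT).finrank_eq, Module.finrank_pi_fintype]
  simp [hfin]

end Representation

namespace DihedralGroup

variable {n : ℕ} [NeZero n]

theorem sum_eq {M : Type*} [AddCommMonoid M] (f : DihedralGroup n → M) :
    ∑ g, f g = ∑ i, f (r i) + ∑ i, f (sr i) := by
  let e : ZMod n ⊕ ZMod n ≃ DihedralGroup n :=
    { toFun := Sum.elim r sr
      invFun
        | r i => .inl i
        | sr i => .inr i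
      left_inv := by rintro (i | i) <;> rfl
      right_inv := by rintro (i | i) <;> rfl }
  rw [← e.sum_comp, Fintype.sum_sum_type]
  rfl

end DihedralGroup

section

variable {n : ℕ} [NeZero n] {k : Type*} [Field k] [CharZero k]

instance (d : ℕ) : FiniteDimensional k ((polygonGraph n).component k d) :=
  Module.Finite.of_basis (PolygonLetter.normalBasis k n d)

/-- The graded trace is `b` on rotations, corrected by `a - b` at the identity, and `c` on
reflections. Its scalar product with a character thus sees only the degree `D` and the sums `A` over
rotations and `B` over reflections. -/
theorem hasGradedMultiplicity_of_character (hn : 2 ≤ n) {V : Type*} [AddCommGroup V] [Module k V]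
    {ρ : Representation k (DihedralGroup n) V} (hρ : ρ.IsIrreducible)
    (hnorm : ∑ i : ZMod n, ρ.character (.r i) * ρ.character (.r (-i)) +
      ∑ i : ZMod n, ρ.character (.sr i) * ρ.character (.sr i) = 2 * n)
    {D A B : ℚ} (hD : ρ.character 1 = algebraMap ℚ k D)
    (hA : ∑ i : ZMod n, ρ.character (.r i) = algebraMap ℚ k A)
    (hB : ∑ i : ZMod n, ρ.character (.sr i) = algebraMap ℚ k B) {f : ℚ⟦X⟧}
    (hf : (2 * n : ℚ) • f = D • (seriesA n - seriesB) + A • seriesB + B • seriesC) :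
    HasGradedMultiplicity ρ f := by
  intro d
  have hn0 : (n : k) ≠ 0 := Nat.cast_ne_zero.2 (NeZero.ne n)
  have hfd := hρ.finiteDimensional
  have hcard : (Nat.card (DihedralGroup n) : k) = 2 * n := by
    rw [DihedralGroup.nat_card]; push_cast; rfl
  let : Invertible (Nat.card (DihedralGroup n) : k) :=
    invertibleOfNonzero (by rw [hcard]; exact mul_ne_zero two_ne_zero hn0)
  -- The character has norm one, so `ρ` has only scalar endomorphisms even if `k` is not
  -- algebraically closed.
  have h1 : Module.finrank k (Representation.IntertwiningMap ρ ρ) = 1 := by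
    have h := ρ.card_inv_mul_sum_char_mul_char_eq_finrank ρ
    rw [DihedralGroup.sum_eq] at h
    simp only [DihedralGroup.inv_r, DihedralGroup.inv_sr] at h
    rw [hnorm, hcard, inv_mul_cancel₀ (mul_ne_zero two_ne_zero hn0)] at h
    exact_mod_cast h.symm
  refine ⟨_, Representation.multiplicity_eq_finrank hρ h1 _, ?_⟩
  have h := ρ.card_inv_mul_sum_char_mul_char_eq_finrank
    (W := (polygonGraph n).component k d) (polygonRep k n d)
  have hr : ∀ i : ZMod n, Representation.character (G := DihedralGroup n)
      (V := (polygonGraph n).component k d) (polygonRep k n d) (.r i) =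
      (if i = 0 then algebraMap ℚ k (PowerSeries.coeff d (seriesA n - seriesB)) else 0) +
        algebraMap ℚ k (PowerSeries.coeff d seriesB) := fun i => by
    split_ifs with hi
    · rw [hi, map_sub, map_sub, sub_add_cancel]
      exact PolygonLetter.hasGradedTrace_one hn k d
    · rw [zero_add]
      exact PolygonLetter.hasGradedTrace_r k hi d
  have hsr : ∀ i : ZMod n, Representation.character (G := DihedralGroup n)
      (V := (polygonGraph n).component k d) (polygonRep k n d) (.sr i) =
      algebraMap ℚ k (PowerSeries.coeff d seriesC) := fun i =>
    PolygonLetter.hasGradedTrace_sr hn k i d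
  have hA' : ∑ i : ZMod n, ρ.character (.r (-i)) = algebraMap ℚ k A := by
    rw [← hA]
    exact Equiv.sum_comp (Equiv.neg (ZMod n)) fun i => ρ.character (.r i)
  have hD' : ρ.character (.r 0) = algebraMap ℚ k D := hD
  rw [DihedralGroup.sum_eq, hcard] at h
  simp only [DihedralGroup.inv_r, DihedralGroup.inv_sr, hr, hsr, add_mul,
    Finset.sum_add_distrib, ← Finset.mul_sum, hA', hB, ite_mul, zero_mul, Finset.sum_ite_eq',
    Finset.mem_univ, if_true, neg_zero, hD'] at h
  rw [inv_mul_eq_iff_eq_mul₀ (mul_ne_zero two_ne_zero hn0)] at h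
  have hf' := congrArg (fun p => algebraMap ℚ k (PowerSeries.coeff d p)) hf
  simp only [map_add, PowerSeries.coeff_smul, smul_eq_mul, map_mul] at hf'
  refine (algebraMap ℚ k).injective ?_
  rw [map_natCast]
  refine mul_left_cancel₀ (mul_ne_zero two_ne_zero hn0 : (2 * n : k) ≠ 0) ?_
  rw [← h]
  simp only [map_ofNat, map_natCast] at hf'
  rw [hf']
  ring

/-- This is the sum of a nontrivial additive character of `ZMod n`. -/
theorem ZMod.sum_pow_val_eq_zero {L : Type*} [Field L] {ξ : L} (h : ξ ^ n = 1) (h1 : ξ ≠ 1) :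
    ∑ i : ZMod n, ξ ^ i.val = 0 := by
  have hn : n ≠ 1 := by rintro rfl; exact h1 (by simpa using h)
  have : Fact (1 < n) := ⟨by have := NeZero.ne n; omega⟩
  refine AddChar.sum_eq_zero_of_ne_one (ψ := AddChar.zmodChar n h) fun hψ => h1 ?_
  have := DFunLike.congr_fun hψ (1 : ZMod n)
  simpa [AddChar.zmodChar_apply, ZMod.val_one] using this

theorem ZMod.pow_val_neg {L : Type*} [Field L] {ξ : L} (h : ξ ^ n = 1) (i : ZMod n) :
    ξ ^ (-i).val = (ξ ^ i.val)⁻¹ := by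
  simpa [AddChar.zmodChar_apply] using AddChar.map_neg_eq_inv (AddChar.zmodChar n h) i

end

/-! ### The irreducible characters of the dihedral group -/

theorem mainTheorem10 (n : ℕ) (hn : 3 ≤ n) (k : Type*) [Field k] [CharZero k]
    (L : Type*) [Field L] [Algebra k L] (ζ : L) (hζ : IsPrimitiveRoot ζ n) :
    -- the graded traces of the identity, of the rotations and of the reflections
    (HasGradedTrace k n 1 (seriesA n) ∧
      (∀ i : ZMod n, i ≠ 0 → HasGradedTrace k n (.r i) seriesB) ∧
      (∀ i : ZMod n, HasGradedTrace k n (.sr i) seriesC)) ∧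
    -- the graded multiplicities of the irreducible representations
    ∀ (V : Type*) [AddCommGroup V] [Module k V] (ρ : Representation k (DihedralGroup n) V),
      ρ.IsIrreducible →
      ((∀ g, ρ.character g = (DihedralChar.triv g : k)) →
        HasGradedMultiplicity ρ ((1 / (2 * n : ℚ)) • seriesA n +
          ((n - 1) / (2 * n) : ℚ) • seriesB + (1 / 2 : ℚ) • seriesC)) ∧
      ((∀ g, ρ.character g = (DihedralChar.oneNeg g : k)) →
        HasGradedMultiplicity ρ ((1 / (2 * n : ℚ)) • seriesA n +
          ((n - 1) / (2 * n) : ℚ) • seriesB - (1 / 2 : ℚ) • seriesC)) ∧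
      (Even n → (∀ g, ρ.character g = (DihedralChar.negOne g : k)) →
        HasGradedMultiplicity ρ ((1 / (2 * n : ℚ)) • (seriesA n - seriesB))) ∧
      (Even n → (∀ g, ρ.character g = (DihedralChar.negNeg g : k)) →
        HasGradedMultiplicity ρ ((1 / (2 * n : ℚ)) • (seriesA n - seriesB))) ∧
      (∀ j : ℕ, 1 ≤ j → 2 * j < n →
        (∀ g, algebraMap k L (ρ.character g) = DihedralChar.two ζ j g) →
        HasGradedMultiplicity ρ ((1 / n : ℚ) • (seriesA n - seriesB))) := by
  have hn2 : 2 ≤ n := by omega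
  have hn0 : (n : ℚ) ≠ 0 := by positivity
  have : NeZero n := ⟨by omega⟩
  have h11 : (-1 : k) ≠ 1 := by norm_num
  refine ⟨⟨PolygonLetter.hasGradedTrace_one hn2 k, fun i => PolygonLetter.hasGradedTrace_r k,
    PolygonLetter.hasGradedTrace_sr hn2 k⟩, ?_⟩
  intro V _ _ ρ hρ
  have hone : (1 : DihedralGroup n) = .r 0 := rfl
  refine ⟨fun h => ?_, fun h => ?_, fun he h => ?_, fun he h => ?_, fun j hj hjn h => ?_⟩
  · refine hasGradedMultiplicity_of_character hn2 hρ (D := 1) (A := n) (B := n) ?_ ?_ ?_ ?_ ?_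
    · simp [h, DihedralChar.triv, two_mul]
    · simp [h, DihedralChar.triv]
    · simp [h, DihedralChar.triv]
    · simp [h, DihedralChar.triv]
    · simp only [smul_add, smul_sub, smul_smul]
      match_scalars <;> (field_simp; try ring)
  · refine hasGradedMultiplicity_of_character hn2 hρ (D := 1) (A := n) (B := -n) ?_ ?_ ?_ ?_ ?_
    · simp [h, DihedralChar.oneNeg, two_mul]
    · exact (h (.r 0)).trans (by simp [DihedralChar.oneNeg])
    · simp [h, DihedralChar.oneNeg]
    · simp [h, DihedralChar.oneNeg]
    · simp only [smul_add, smul_sub, smul_smul]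
      match_scalars <;> (field_simp; try ring)
  · have hsum : ∑ i : ZMod n, (-1 : k) ^ i.val = 0 := ZMod.sum_pow_val_eq_zero he.neg_one_pow h11
    have hneg : ∀ i : ZMod n, (-1 : k) ^ (-i).val = (-1) ^ i.val := fun i => by
      rw [ZMod.pow_val_neg he.neg_one_pow, ← inv_pow, inv_neg_one]
    have hsq : ∀ i : ZMod n, (-1 : k) ^ i.val * (-1) ^ i.val = 1 := fun i => by
      rw [← mul_pow]; simp
    refine hasGradedMultiplicity_of_character hn2 hρ (D := 1) (A := 0) (B := 0) ?_ ?_ ?_ ?_ ?_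
    · simp [h, DihedralChar.negOne, two_mul, hneg, hsq]
    · exact (h (.r 0)).trans (by simp [DihedralChar.negOne])
    · simp [h, DihedralChar.negOne, hsum]
    · simp [h, DihedralChar.negOne, hsum]
    · simp only [smul_sub, smul_smul]
      match_scalars <;> (field_simp; try ring)
  · have hsum : ∑ i : ZMod n, (-1 : k) ^ i.val = 0 := ZMod.sum_pow_val_eq_zero he.neg_one_pow h11
    have hneg : ∀ i : ZMod n, (-1 : k) ^ (-i).val = (-1) ^ i.val := fun i => by
      rw [ZMod.pow_val_neg he.neg_one_pow, ← inv_pow, inv_neg_one]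
    have hsq : ∀ i : ZMod n, (-1 : k) ^ i.val * (-1) ^ i.val = 1 := fun i => by
      rw [← mul_pow]; simp
    refine hasGradedMultiplicity_of_character hn2 hρ (D := 1) (A := 0) (B := 0) ?_ ?_ ?_ ?_ ?_
    · simp [h, DihedralChar.negNeg, two_mul, hneg, hsq]
    · exact (h (.r 0)).trans (by simp [DihedralChar.negNeg])
    · simp [h, DihedralChar.negNeg, hsum]
    · simp [h, DihedralChar.negNeg, hsum]
    · simp only [smul_sub, smul_smul]
      match_scalars <;> (field_simp; try ring)
  -- The roots of unity live in `L`, so the character sums are computed there and pulled back to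
  -- `k`.
  · have hinj := (algebraMap k L).injective
    have hζ0 : ζ ≠ 0 := hζ.ne_zero (by omega)
    have hpow : ∀ m, (ζ ^ m) ^ n = 1 := fun m => by rw [pow_right_comm, hζ.pow_eq_one, one_pow]
    have hinv : ∀ m, ((ζ ^ m)⁻¹) ^ n = 1 := fun m => by rw [inv_pow, hpow, inv_one]
    have h1 : ζ ^ j ≠ 1 := hζ.pow_ne_one_of_pos_of_lt (by omega) (by omega)
    -- The condition `2 * j < n` enters here: it kills the outer terms of `(ξ + ξ⁻¹)² = ξ² + 2 +
    -- ξ⁻²` after summation and leaves the norm `2n`.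
    have h2 : ζ ^ (2 * j) ≠ 1 := hζ.pow_ne_one_of_pos_of_lt (by omega) (by omega)
    have hr : ∀ i : ZMod n, algebraMap k L (ρ.character (.r i)) =
        (ζ ^ j) ^ i.val + ((ζ ^ j)⁻¹) ^ i.val := fun i => by
      rw [h, DihedralChar.two, pow_mul, inv_pow]
    have hsr : ∀ i : ZMod n, ρ.character (.sr i) = 0 := fun i =>
      hinj (by rw [h, DihedralChar.two, map_zero])
    refine hasGradedMultiplicity_of_character hn2 hρ (D := 2) (A := 0) (B := 0) ?_ ?_ ?_ ?_ ?_
    · have hprod : ∀ i : ZMod n, algebraMap k L (ρ.character (.r i) * ρ.character (.r (-i))) =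
          (ζ ^ (2 * j)) ^ i.val + 2 + ((ζ ^ (2 * j))⁻¹) ^ i.val := fun i => by
        have hz : (ζ ^ j) ^ i.val ≠ 0 := pow_ne_zero _ (pow_ne_zero _ hζ0)
        rw [map_mul, hr, hr, ZMod.pow_val_neg (hpow j), ZMod.pow_val_neg (hinv j), mul_comm 2 j,
          pow_mul ζ j 2, inv_pow, inv_pow, inv_inv, pow_right_comm]
        field_simp
        ring
      refine hinj ?_
      simp only [hsr, mul_zero, Finset.sum_const_zero, add_zero, map_sum, hprod,
        Finset.sum_add_distrib]
      rw [ZMod.sum_pow_val_eq_zero (hpow _) h2,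
        ZMod.sum_pow_val_eq_zero (hinv _) (inv_ne_one.2 h2)]
      simp [ZMod.card, mul_comm, map_ofNat (algebraMap k L)]
    · refine hinj ?_
      rw [hone, hr, map_ofNat, map_ofNat, ZMod.val_zero, pow_zero, pow_zero, one_add_one_eq_two]
    · refine hinj ?_
      simp only [map_sum, hr, Finset.sum_add_distrib]
      rw [ZMod.sum_pow_val_eq_zero (hpow _) h1,
        ZMod.sum_pow_val_eq_zero (hinv _) (inv_ne_one.2 h1)]
      simp
    · simp [hsr]
    · simp only [smul_sub, smul_smul]
      match_scalars <;> (field_simp; try ring)
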